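/- Let $0<\alpha\le 1$. For $M\ge 0$ write $H_\alpha(M)$ for the $2\pi$-periodic functions $x:\mathbb R\to\mathbb C$ with $|x(s)-x(t)|\le M|s-t|^\alpha$, and $H_{\alpha\alpha}(M)$ for the functions $g:\mathbb R^2\to\mathbb C$, $2\pi$-periodic in each variable, with $|g(s,\sigma)-g(s',\sigma')|\le M(|s-s'|^\alpha+|\sigma-\sigma'|^\alpha)$; $H_\alpha=\bigcup_M H_\alpha(M)$. Consider the singular integral equation on the circle $$a(s)x(s)+\frac{b(s)}{2\pi}\int_0^{2\pi}x(\sigma)\operatorname{ctg}\frac{\sigma-s}{2}\,d\sigma+\frac1{2\pi}\int_0^{2\pi}g(s,\sigma)x(\sigma)\,d\sigma=f(s),\qquad(1)$$ the first integral being a Cauchy principal value. Here $b(s)\neq0$ for all $s$; nothing is assumed about $a^2-b^2$, which may vanish on arbitrary sets or identically. For $n\ge1$ and $0<h\le\frac{\pi}{2n}$ put $s_k=\frac{\pi k}{n}$, $s_k^*=s_k+h$ and $$\psi_k(s)=\frac1{2n+1}\,\frac{\sin\frac{2n+1}{2}(s-s_k^*)}{\sin\frac{s-s_k^*}{2}}$$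 (extended by continuity). The approximate solution is sought as $x_n=\sum_{k=0}^{2n-1}c_k\psi_k$, $c_k\in\mathbb C$, from the system $$a(s_j^*)x_n(s_j^*)+\frac{b(s_j^*)}{2\pi}\sum_{\substack{k=0\\k\ne j-1,\,j+1}}^{2n-1}x_n(s_k^*)\int_{s_k}^{s_{k+1}}\operatorname{ctg}\frac{\sigma-s_j^*}{2}\,d\sigma+\frac{1}{2n}\sum_{k=0}^{2n-1}g(s_j^*,s_k^*)x_n(s_k^*)=f(s_j^*),\quad j=0,\dots,2n-1,\qquad(2)$$ where $j\pm1$ is read modulo $2n$ and the integral with $k=j$ is a principal value. Let $C=(c_{jk})$ be the matrix of (2) acting on the vector $(x_n(s_k^*))_k$. Given $\delta>0$, say that $C$ is diagonally dominant with gap $\delta$ if $|c_{jj}|\ge\delta+\sum_{k\ne j}|c_{jk}|$ for all $j$. For every $\alpha\in(0,1]$, $M$ and $\delta>0$ there is a constant $A$, depending only on $\alpha,M,\delta$, such that the following holds. Let $a,f\in H_\alpha$; $b\in H_\alpha(M)$ with $|b|\le M$ and $b(s)\ne0$ for all $s$; $g\in H_{\alpha\alpha}(M)$ with $|g|\le M$;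 and let (1) have a solution $x^*\in H_\alpha(M)$, $|x^*|\le M$, which is its only solution in $H_\alpha$. Then: (i) For every $n\ge1$ there is $h_0\in(0,\frac{\pi}{2n}]$ such that for all $0<h\le h_0$ the matrix $C$ is diagonally dominant with gap $\delta$ and (2) is uniquely solvable. (ii) Let $n\ge2$ and let $0<h\le\frac{\pi}{2n}$ be any shift for which $C$ is diagonally dominant with gap $\delta$ (by (i), this is the case for all sufficiently small $h$). Then (2) has a unique solution $x_n^*$. If moreover the slopes $k_j$ ($0\le j\le 2n-1$) of the straight lines $\psi(\sigma)=x^*(s_j^*)+k_j(\sigma-s_j^*)$ determined by $$\int_{s_{j-1}}^{s_j}\psi(\sigma)\operatorname{ctg}\frac{\sigma-s_j^*}{2}\,d\sigma+\int_{s_{j+1}}^{s_{j+2}}\psi(\sigma)\operatorname{ctg}\frac{\sigma-s_j^*}{2}\,d\sigma=0$$ satisfy $\max_j|k_j|\le n^{1-\alpha}$, then $$\|x^*-x_n^*\|_C=\sup_s|x^*(s)-x_n^*(s)|\le A\,\frac{\ln^3n}{n^\alpha}.$$ -/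

import Mathlib

open Filter Topology

noncomputable section

namespace HilbertSIE

/-- The class `H_α(M)` on the circle: `2π`-periodic functions satisfying a Hölder condition with
exponent `α` and constant `M`. -/
def IsHolder (α M : ℝ) (x : ℝ → ℂ) : Prop :=
  Function.Periodic x (2 * Real.pi) ∧ ∀ s t, ‖x s - x t‖ ≤ M * |s - t| ^ α

/-- The class `H_{αα}(M)` of kernels on the torus. -/
def IsHolderKernel (α M : ℝ) (H : ℝ → ℝ → ℂ) : Prop :=
  (∀ σ, Function.Periodic (fun s => H s σ) (2 * Real.pi)) ∧
  (∀ s, Function.Periodic (H s) (2 * Real.pi)) ∧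
  ∀ s s' σ σ', ‖H s σ - H s' σ'‖ ≤ M * (|s - s'| ^ α + |σ - σ'| ^ α)

/-- `p` is the Cauchy principal value of `∫₀^{2π} x(σ) ctg((σ - s)/2) dσ`: by periodicity the
integral is taken over the period `(s, s + 2π)`, and the arc of radius `ε` about the singular
point is removed at both of its ends. -/
def HasHilbertPV (x : ℝ → ℂ) (s : ℝ) (p : ℂ) : Prop :=
  Tendsto (fun ε : ℝ => ∫ σ in (s + ε)..(s + 2 * Real.pi - ε),
    x σ * (Real.cot ((σ - s) / 2) : ℂ)) (𝓝[>] 0) (𝓝 p)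

/-- `x` solves the singular integral equation
`a(s) x(s) + b(s)/(2π) ∫₀^{2π} x(σ) ctg((σ-s)/2) dσ + 1/(2π) ∫₀^{2π} H(s,σ) x(σ) dσ = f(s)`. -/
def IsSolution (a b : ℝ → ℂ) (H : ℝ → ℝ → ℂ) (f x : ℝ → ℂ) : Prop :=
  ∀ s, ∃ p, HasHilbertPV x s p ∧
    a s * x s + b s / (2 * Real.pi) * p
      + 1 / (2 * Real.pi) * (∫ σ in (0 : ℝ)..(2 * Real.pi), H s σ * x σ) = f s

/-- The knots `s_k = π k / n`. -/
def knot (n : ℕ) (k : ℤ) : ℝ := Real.pi * k / n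

/-- The shifted knots `s_k^* = π k / n + h`. -/
def shiftedKnot (n : ℕ) (h : ℝ) (k : ℤ) : ℝ := knot n k + h

/-- The basis function
`ψ_k(s) = (1/(2n+1)) sin((2n+1)(s - s_k^*)/2) / sin((s - s_k^*)/2)`,
written as a Dirichlet sum, which also gives its value where the denominator vanishes. -/
def basisFun (n : ℕ) (h : ℝ) (k : ℤ) (s : ℝ) : ℝ :=
  1 / (2 * n + 1) * (1 + 2 * ∑ m ∈ Finset.Icc 1 n, Real.cos (m * (s - shiftedKnot n h k)))

theorem basisFun_eq (n : ℕ) (h : ℝ) (k : ℤ) (s : ℝ)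
    (hs : Real.sin ((s - shiftedKnot n h k) / 2) ≠ 0) :
    basisFun n h k s = 1 / (2 * n + 1) *
      (Real.sin ((2 * n + 1) / 2 * (s - shiftedKnot n h k)) /
        Real.sin ((s - shiftedKnot n h k) / 2)) := by
  unfold basisFun
  generalize s - shiftedKnot n h k = t at hs ⊢
  congr 1
  rw [eq_div_iff hs]
  induction n with
  | zero => simp; congr 1; ring
  | succ n ih =>
    rw [Finset.sum_Icc_succ_top (by omega)]
    have e1 : (2 * ((n + 1 : ℕ) : ℝ) + 1) / 2 * t = ((n + 1 : ℕ) : ℝ) * t + t / 2 := by ring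
    have e2 : (2 * (n : ℝ) + 1) / 2 * t = ((n + 1 : ℕ) : ℝ) * t - t / 2 := by push_cast; ring
    rw [e1, Real.sin_add]
    rw [e2, Real.sin_sub] at ih
    linear_combination ih

/-- The approximate solution `x_n(s) = ∑_{k=0}^{2n-1} c_k ψ_k(s)`. -/
def approxSol (n : ℕ) (h : ℝ) (c : Fin (2 * n) → ℂ) (s : ℝ) : ℂ :=
  ∑ k : Fin (2 * n), c k * (basisFun n h (k : ℕ) s : ℂ)

/-- The integral `∫_{s_k}^{s_{k+1}} ctg((σ - s_j^*)/2) dσ`; for `k = j` it is a principal value,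
and for the other `k` in `0, …, 2n-1` the limit is the ordinary integral. -/
def cellWeight (n : ℕ) (h : ℝ) (j k : Fin (2 * n)) : ℝ :=
  limUnder (𝓝[>] (0 : ℝ)) fun ε : ℝ =>
    ∫ σ in Set.Icc (knot n (k : ℕ)) (knot n ((k : ℕ) + 1)) \
        Metric.ball (shiftedKnot n h (j : ℕ)) ε,
      Real.cot ((σ - shiftedKnot n h (j : ℕ)) / 2)

/-- `k = j - 1` or `k = j + 1`, the `2n` indices being read cyclically. -/
def Neighbor {n : ℕ} (j k : Fin (2 * n)) : Prop :=
  ((k : ℕ) + 1) % (2 * n) = j ∨ ((j : ℕ) + 1) % (2 * n) = k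

open Classical in
/-- The matrix `C` of the quadrature system, acting on the vector of values `x(s_k^*)`. -/
def systemMatrix (n : ℕ) (h : ℝ) (a b : ℝ → ℂ) (H : ℝ → ℝ → ℂ) :
    Matrix (Fin (2 * n)) (Fin (2 * n)) ℂ := fun j k =>
  (if k = j then a (shiftedKnot n h (j : ℕ)) else 0)
    + (if Neighbor j k then 0 else
        b (shiftedKnot n h (j : ℕ)) / (2 * Real.pi) * (cellWeight n h j k : ℂ))
    + 1 / (2 * n) * H (shiftedKnot n h (j : ℕ)) (shiftedKnot n h (k : ℕ))

/-- The coefficients `c` solve the quadrature system: the values `x_n(s_k^*)` of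
`x_n = ∑ c_k ψ_k` satisfy, for `j = 0, …, 2n-1`,
`a(s_j^*) x_n(s_j^*) + b(s_j^*)/(2π) ∑_{k ≠ j-1, j+1} x_n(s_k^*) ∫_{s_k}^{s_{k+1}} ctg((σ-s_j^*)/2) dσ
  + (1/(2n)) ∑_k H(s_j^*, s_k^*) x_n(s_k^*) = f(s_j^*)`. -/
def SolvesSystem (n : ℕ) (h : ℝ) (a b : ℝ → ℂ) (H : ℝ → ℝ → ℂ) (f : ℝ → ℂ)
    (c : Fin (2 * n) → ℂ) : Prop :=
  ∀ j : Fin (2 * n),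
    ∑ k : Fin (2 * n), systemMatrix n h a b H j k * approxSol n h c (shiftedKnot n h (k : ℕ))
      = f (shiftedKnot n h (j : ℕ))

/-- Every diagonal entry exceeds in modulus the sum of the moduli of the other entries of its row
by at least `δ`; for `δ > 0` this is strict diagonal dominance. -/
def DiagDominant {n : ℕ} (δ : ℝ) (C : Matrix (Fin (2 * n)) (Fin (2 * n)) ℂ) : Prop :=
  ∀ j, (∑ k ∈ Finset.univ.erase j, ‖C j k‖) + δ ≤ ‖C j j‖

/-- `κ` is the slope of the straight line `ψ(σ) = x(s_j^*) + κ (σ - s_j^*)` through the value of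
`x` at `s_j^*` for which
`∫_{s_{j-1}}^{s_j} ψ(σ) ctg((σ-s_j^*)/2) dσ + ∫_{s_{j+1}}^{s_{j+2}} ψ(σ) ctg((σ-s_j^*)/2) dσ = 0`. -/
def IsAuxSlope (n : ℕ) (h : ℝ) (x : ℝ → ℂ) (j : ℤ) (κ : ℂ) : Prop :=
  (∫ σ in (knot n (j - 1))..(knot n j),
      (x (shiftedKnot n h j) + κ * ((σ - shiftedKnot n h j : ℝ) : ℂ))
        * (Real.cot ((σ - shiftedKnot n h j) / 2) : ℂ))
    + (∫ σ in (knot n (j + 1))..(knot n (j + 2)),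
      (x (shiftedKnot n h j) + κ * ((σ - shiftedKnot n h j : ℝ) : ℂ))
        * (Real.cot ((σ - shiftedKnot n h j) / 2) : ℂ)) = 0

end HilbertSIE

end

namespace HilbertSIE

/-! ### Cyclic sums -/

/-! Diagonal dominance. The principal value over the cell of `s_j^*` is `2 log (sin ((π/n - h)/2) /
sin (h/2))`, which tends to infinity as `h → 0` with `n` fixed. The cell to the left also ends at
distance `h` from `s_j^*`, so its weight would blow up too, but the system omits both neighbours.
All other weights are at most `2π` in modulus, and `|b|` is bounded below by compactness, so the
diagonal wins for small `h` (`exists_diagDominant`). The vanishing of `a² - b²` plays no role.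

Convergence. A gap `δ` bounds the inverse of `C` in the maximum norm by `1/δ`
(`DiagDominant.norm_le`), so the nodal errors are at most the residual of `x^*` in the system
divided by `δ`. The residual is a quadrature error (`norm_residual_le`). In the central cell the
Hölder condition cancels the singularity. In the two omitted cells `x^*` is compared with the
auxiliary line, whose contribution vanishes and whose slope bound keeps it Hölder-close to `x^*` at
scale `1/n`. The remaining cells give a harmonic sum. In total the residual is `O(log n / n^α)`
(`norm_quadrature_error_le`, `norm_riemann_sum_error_le`).

From nodes to the whole circle. The `ψ_k` are not Lagrange functions, but they lie in the space of
trigonometric interpolants at the `2n` nodes, so `x_n` is the interpolant of its own nodal values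
(`approxSol_eq_sum_lagrange`). The uniform error is then the interpolation error of `x^*`, `O(log n
/ n^α)` (`norm_sum_sub_mul_lagrange_le`), plus the nodal error times the Lebesgue constant `O(log
n)` (`sum_abs_lagrange_le`). This yields a `log²` bound, which the stated `log³` absorbs. -/

theorem sum_range_int_shift {β : Type*} [AddCommGroup β] {N : ℕ} {F : ℤ → β}
    (hF : ∀ k, F (k + N) = F k) (j : ℤ) :
    ∑ i ∈ Finset.range N, F (j + i) = ∑ i ∈ Finset.range N, F i := by
  have step : ∀ j : ℤ, ∑ i ∈ Finset.range N, F (j + 1 + i) = ∑ i ∈ Finset.range N, F (j + i) := by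
    intro j
    have h1 := Finset.sum_range_succ (fun i : ℕ => F (j + i)) N
    have h2 := Finset.sum_range_succ' (fun i : ℕ => F (j + i)) N
    have h3 : ∀ i : ℕ, F (j + 1 + i) = F (j + (i + 1 : ℕ)) := by
      intro i; congr 1; push_cast; ring
    simp only [h3]
    rw [h1] at h2
    simp only [Nat.cast_zero, add_zero, hF] at h2
    exact (add_right_cancel h2).symm
  induction j with
  | zero => simp
  | succ k ih => rw [step, ih]
  | pred k ih => rw [← ih, ← step (-(k : ℤ) - 1)]; simp

theorem sum_fin_eq_sum_range_shift {β : Type*} [AddCommGroup β] {N : ℕ} {F : ℤ → β}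
    (hF : ∀ k, F (k + N) = F k) (j : ℤ) :
    ∑ k : Fin N, F ((k : ℕ) : ℤ) = ∑ i ∈ Finset.range N, F (j + i) := by
  rw [sum_range_int_shift hF, ← Fin.sum_univ_eq_sum_range (fun i : ℕ => F (i : ℤ))]

/-! ### Nodes and Hölder functions -/

theorem shiftedKnot_add (n : ℕ) (h : ℝ) (j k : ℤ) :
    shiftedKnot n h (j + k) = shiftedKnot n h j + Real.pi * k / n := by
  simp only [shiftedKnot, knot]; push_cast; ring

theorem shiftedKnot_add_period {n : ℕ} (hn : 1 ≤ n) (h : ℝ) (k : ℤ) :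
    shiftedKnot n h (k + (2 * n : ℕ)) = shiftedKnot n h k + 2 * Real.pi := by
  rw [shiftedKnot_add]
  have : (n : ℝ) ≠ 0 := by positivity
  push_cast; field_simp

theorem IsHolder.const_nonneg {α M : ℝ} {x : ℝ → ℂ} (hx : IsHolder α M x) : 0 ≤ M := by
  have := hx.2 0 1
  simp only [zero_sub, abs_neg, abs_one, Real.one_rpow, mul_one] at this
  exact (norm_nonneg _).trans this

theorem IsHolder.continuous {α M : ℝ} {x : ℝ → ℂ} (hα : 0 < α) (hx : IsHolder α M x) :
    Continuous x := by
  rw [continuous_iff_continuousAt]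
  intro t
  rw [ContinuousAt, tendsto_iff_norm_sub_tendsto_zero]
  have h1 : Tendsto (fun s : ℝ => M * |s - t| ^ α) (𝓝 t) (𝓝 (M * |t - t| ^ α)) := by
    have : Continuous fun s : ℝ => M * |s - t| ^ α :=
      continuous_const.mul ((continuous_abs.comp (continuous_id.sub continuous_const)).rpow_const
        (fun _ => Or.inr hα.le))
    exact this.tendsto t
  rw [sub_self, abs_zero, Real.zero_rpow hα.ne', mul_zero] at h1
  exact squeeze_zero (fun _ => norm_nonneg _) (fun s => hx.2 s t) h1

/-! ### Elementary bounds -/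

/-- Jordan's inequality on each half of `(0, π)`. Keeping both reciprocals treats the two ends of
the period at once and turns sums over nodes into harmonic sums. -/
theorem inv_sin_le {u : ℝ} (h0 : 0 < u) (h1 : u < Real.pi) :
    1 / Real.sin u ≤ Real.pi / 2 * (1 / u + 1 / (Real.pi - u)) := by
  have hpi := Real.pi_pos
  have key : ∀ v : ℝ, 0 < v → v ≤ Real.pi / 2 → 1 / Real.sin v ≤ Real.pi / 2 * (1 / v) := by
    intro v hv hv'
    have := Real.mul_le_sin hv.le hv'
    calc 1 / Real.sin v ≤ 1 / (2 / Real.pi * v) := one_div_le_one_div_of_le (by positivity) this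
      _ = Real.pi / 2 * (1 / v) := by field_simp
  have hu : 0 < 1 / u := by positivity
  have hu' : 0 < 1 / (Real.pi - u) := one_div_pos.2 (by linarith)
  rcases le_total u (Real.pi / 2) with h | h
  · refine (key u h0 h).trans ?_
    gcongr; linarith
  · have := key (Real.pi - u) (by linarith) (by linarith)
    rw [Real.sin_pi_sub] at this
    refine this.trans ?_
    gcongr; linarith

theorem abs_cot_le_inv_sin {u : ℝ} (h0 : 0 < u) (h1 : u < Real.pi) :
    |Real.cot u| ≤ 1 / Real.sin u := by
  have := Real.sin_pos_of_pos_of_lt_pi h0 h1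
  rw [Real.cot_eq_cos_div_sin, abs_div, abs_of_pos this]
  gcongr
  exact Real.abs_cos_le_one u

theorem sum_inv_succ_le {m n : ℕ} (hmn : m ≤ n) :
    ∑ r ∈ Finset.range m, 1 / ((r : ℝ) + 1) ≤ 1 + Real.log n := by
  have h1 : ((harmonic n : ℚ) : ℝ) = ∑ r ∈ Finset.range n, 1 / ((r : ℝ) + 1) := by
    rw [harmonic]; push_cast; simp
  refine le_trans ?_ (harmonic_le_one_add_log n)
  rw [h1]
  exact Finset.sum_le_sum_of_subset_of_nonneg (Finset.range_mono hmn) (fun _ _ _ => by positivity)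

theorem sum_inv_add_inv_reflect_le {m n : ℕ} (hmn : m ≤ n) :
    ∑ r ∈ Finset.range m, (1 / ((r : ℝ) + 1) + 1 / ((m : ℝ) - r)) ≤ 2 * (1 + Real.log n) := by
  have h1 : ∑ r ∈ Finset.range m, 1 / ((m : ℝ) - r) = ∑ r ∈ Finset.range m, 1 / ((r : ℝ) + 1) := by
    rw [← Finset.sum_range_reflect]
    refine Finset.sum_congr rfl fun r hr => ?_
    have : r + 1 ≤ m := Finset.mem_range.1 hr
    rw [Nat.cast_sub (by omega), Nat.cast_sub (by omega)]
    congr 1; push_cast; ring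
  rw [Finset.sum_add_distrib, h1]
  linarith [sum_inv_succ_le hmn]

theorem one_add_log_two_mul_le {n : ℕ} (hn : 2 ≤ n) :
    1 + Real.log ((2 * n : ℕ) : ℝ) ≤ 4 * Real.log n := by
  have h2 : (2 : ℝ) ≤ n := by exact_mod_cast hn
  have h3 : Real.log 2 ≤ Real.log n := Real.log_le_log (by norm_num) h2
  push_cast
  rw [Real.log_mul (by norm_num) (by positivity)]
  linarith [Real.log_two_gt_d9]

theorem half_le_log {n : ℕ} (hn : 2 ≤ n) : 1 / 2 ≤ Real.log n := by
  have h2 : (2 : ℝ) ≤ n := by exact_mod_cast hn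
  have h3 : Real.log 2 ≤ Real.log n := Real.log_le_log (by norm_num) h2
  linarith [Real.log_two_gt_d9]

/-! ### The trigonometric Lagrange kernel -/

/-- Discrete orthogonality on the grid. Multiplication by `2 sin (d/2)` makes the sum telescope over
a full period, and `0 < q < 2n` keeps this factor nonzero. -/
theorem sum_cos_add_mul_eq_zero {n : ℕ} (q : ℕ) (hq : 1 ≤ q) (hq' : q < 2 * n) (A : ℝ) :
    ∑ j ∈ Finset.range (2 * n), Real.cos (A + q * (Real.pi * j / n)) = 0 := by
  have hn : (0 : ℝ) < n := by exact_mod_cast (by omega : 0 < n)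
  set d : ℝ := q * (Real.pi / n) with hd
  have hs : Real.sin (d / 2) ≠ 0 := by
    apply ne_of_gt
    apply Real.sin_pos_of_pos_of_lt_pi
    · have : (0 : ℝ) < q := by exact_mod_cast hq
      have := Real.pi_pos
      positivity
    · have : (q : ℝ) < 2 * n := by exact_mod_cast hq'
      rw [hd, div_lt_iff₀ (by norm_num), ← mul_div_assoc, div_lt_iff₀ hn]
      nlinarith [Real.pi_pos]
  have tel : ∀ j : ℕ, Real.cos (A + q * (Real.pi * j / n)) * (2 * Real.sin (d / 2))
      = Real.sin (A + (j + 1 : ℕ) * d - d / 2) - Real.sin (A + (j : ℕ) * d - d / 2) := by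
    intro j
    rw [Real.sin_sub_sin]
    have e1 : (A + (j + 1 : ℕ) * d - d / 2 - (A + j * d - d / 2)) / 2 = d / 2 := by push_cast; ring
    have e2 : (A + (j + 1 : ℕ) * d - d / 2 + (A + j * d - d / 2)) / 2
        = A + q * (Real.pi * j / n) := by rw [hd]; push_cast; ring
    rw [e1, e2]; ring
  have h0 : (∑ j ∈ Finset.range (2 * n), Real.cos (A + q * (Real.pi * j / n)))
      * (2 * Real.sin (d / 2)) = 0 := by
    rw [Finset.sum_mul, Finset.sum_congr rfl (fun j _ => tel j),
      Finset.sum_range_sub (fun j : ℕ => Real.sin (A + j * d - d / 2))]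
    have : A + (2 * n : ℕ) * d - d / 2 = A + (0 : ℕ) * d - d / 2 + (q : ℕ) * (2 * Real.pi) := by
      rw [hd]; push_cast; field_simp; ring
    rw [this, Real.sin_add_nat_mul_two_pi, sub_self]
  exact (mul_eq_zero.1 h0).resolve_right (mul_ne_zero two_ne_zero hs)

/-- The Lagrange kernel of trigonometric interpolation at `2n` equidistant nodes. -/
noncomputable def lagrange (n : ℕ) (t : ℝ) : ℝ :=
  1 / (2 * n) * (1 + 2 * ∑ m ∈ Finset.Ico 1 n, Real.cos (m * t) + Real.cos (n * t))

theorem lagrange_neg (n : ℕ) (t : ℝ) : lagrange n (-t) = lagrange n t := by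
  simp [lagrange, Real.cos_neg]

theorem lagrange_periodic (n : ℕ) : Function.Periodic (lagrange n) (2 * Real.pi) := by
  intro t
  simp only [lagrange, mul_add, Real.cos_add_nat_mul_two_pi]

/-- The closed form `sin (nt) cot (t/2) / (2n)` of the kernel, cleared of its denominator. -/
theorem lagrange_mul_sin {n : ℕ} (hn : 1 ≤ n) (t : ℝ) :
    lagrange n t * Real.sin (t / 2) = 1 / (2 * n) * (Real.sin (n * t) * Real.cos (t / 2)) := by
  unfold lagrange
  rw [mul_assoc]
  congr 1
  induction n, hn using Nat.le_induction with
  | base =>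
    have := Real.sin_two_mul (t / 2)
    have h2 := Real.cos_two_mul (t / 2)
    rw [mul_div_cancel₀ t two_ne_zero] at this h2
    simp only [Finset.Ico_self, Finset.sum_empty, Nat.cast_one, one_mul, this, h2]
    ring
  | succ n hn ih =>
    rw [Finset.sum_Ico_succ_top hn]
    have e : ((n + 1 : ℕ) : ℝ) * t = n * t + (t / 2 + t / 2) := by push_cast; ring
    rw [e]
    simp only [Real.sin_add, Real.cos_add]
    have hsq := Real.sin_sq_add_cos_sq (t / 2)
    set S := Real.sin (t / 2)
    set K := Real.cos (t / 2)
    set P := Real.sin (n * t)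
    set Q := Real.cos (n * t)
    linear_combination ih + (-P * K - Q * S) * hsq

theorem abs_lagrange_le_one {n : ℕ} (hn : 1 ≤ n) (t : ℝ) : |lagrange n t| ≤ 1 := by
  have hn' : (0 : ℝ) < n := by exact_mod_cast hn
  have h1 : |∑ m ∈ Finset.Ico 1 n, Real.cos (m * t)| ≤ n - 1 := by
    refine (Finset.abs_sum_le_sum_abs _ _).trans ?_
    refine (Finset.sum_le_sum fun (m : ℕ) _ => Real.abs_cos_le_one (m * t)).trans ?_
    simp [Nat.cast_sub hn]
  have h2 := Real.abs_cos_le_one (n * t)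
  rw [lagrange, abs_mul, abs_of_pos (by positivity), one_div, inv_mul_le_iff₀ (by positivity),
    mul_one, abs_le]
  rw [abs_le] at h1 h2
  constructor <;> linarith

theorem lagrange_eq {n : ℕ} (hn : 1 ≤ n) {t : ℝ} (ht : Real.sin (t / 2) ≠ 0) :
    lagrange n t = 1 / (2 * n) * (Real.sin (n * t) * Real.cot (t / 2)) := by
  rw [Real.cot_eq_cos_div_sin, ← mul_div_assoc, ← mul_div_assoc, eq_div_iff ht,
    lagrange_mul_sin hn]

theorem cos_mul_sub_shiftedKnot (n : ℕ) (h s : ℝ) (m j : ℕ) :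
    Real.cos (m * (s - shiftedKnot n h (j : ℕ)))
      = Real.cos (-(m * (s - h)) + m * (Real.pi * j / n)) := by
  rw [← Real.cos_neg]; congr 1; simp only [shiftedKnot, knot]; push_cast; ring

theorem cos_degree_mul_sub_shiftedKnot {n : ℕ} (hn : 1 ≤ n) (h s : ℝ) (j : ℕ) :
    Real.cos (n * (s - shiftedKnot n h (j : ℕ))) = (-1) ^ j * Real.cos (n * (s - h)) := by
  have hn' : (n : ℝ) ≠ 0 := by positivity
  have : n * (s - shiftedKnot n h (j : ℕ)) = n * (s - h) - (j : ℕ) * Real.pi := by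
    simp only [shiftedKnot, knot]; push_cast; field_simp; ring
  rw [this, Real.cos_sub_nat_mul_pi]

theorem sum_cos_mul_sub_shiftedKnot {n : ℕ} (h s : ℝ) {m : ℕ} (hm : 1 ≤ m) (hm' : m < 2 * n) :
    ∑ j ∈ Finset.range (2 * n), Real.cos (m * (s - shiftedKnot n h (j : ℕ))) = 0 := by
  simp only [cos_mul_sub_shiftedKnot]
  exact sum_cos_add_mul_eq_zero m hm hm' _

/-- On the grid the sign `(-1)^j` is itself an oscillation of frequency `n`, so it turns the
frequency `m` into `n - m`, which lies in `1, …, n`, and orthogonality applies. -/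
theorem sum_alternating_cos_mul_sub_shiftedKnot {n : ℕ} (h s : ℝ) {m : ℕ} (hm' : m < n) :
    ∑ j ∈ Finset.range (2 * n), (-1) ^ j * Real.cos (m * (s - shiftedKnot n h (j : ℕ))) = 0 := by
  have hn' : (n : ℝ) ≠ 0 := by exact_mod_cast (by omega : n ≠ 0)
  rw [← sum_cos_add_mul_eq_zero (n := n) (n - m) (by omega) (by omega) (m * (s - h))]
  refine Finset.sum_congr rfl fun j _ => ?_
  rw [← Real.cos_add_nat_mul_pi, Nat.cast_sub hm'.le]
  congr 1
  simp only [shiftedKnot, knot]; push_cast; field_simp; ring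

theorem sum_lagrange {n : ℕ} (hn : 1 ≤ n) (h s : ℝ) :
    ∑ j ∈ Finset.range (2 * n), lagrange n (s - shiftedKnot n h (j : ℕ)) = 1 := by
  have hn' : (n : ℝ) ≠ 0 := by positivity
  simp only [lagrange]
  rw [← Finset.mul_sum, Finset.sum_add_distrib, Finset.sum_add_distrib, ← Finset.mul_sum,
    Finset.sum_comm, sum_cos_mul_sub_shiftedKnot h s hn (by omega),
    Finset.sum_eq_zero (s := Finset.Ico 1 n) fun m hm => sum_cos_mul_sub_shiftedKnot h s
      (Finset.mem_Ico.1 hm).1 (by have := (Finset.mem_Ico.1 hm).2; omega)]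
  simp; field_simp

/-- The interpolant of the grid oscillation is the single top-frequency cosine. This is what places
the `ψ_k` in the interpolation space. -/
theorem sum_alternating_lagrange {n : ℕ} (hn : 1 ≤ n) (h s : ℝ) :
    ∑ j ∈ Finset.range (2 * n), (-1) ^ j * lagrange n (s - shiftedKnot n h (j : ℕ))
      = Real.cos (n * (s - h)) := by
  have hn' : (n : ℝ) ≠ 0 := by positivity
  have e : ∀ j : ℕ, (-1) ^ j * lagrange n (s - shiftedKnot n h (j : ℕ))
      = 1 / (2 * n) * ((-1) ^ j * Real.cos ((0 : ℕ) * (s - shiftedKnot n h (j : ℕ)))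
        + 2 * ∑ m ∈ Finset.Ico 1 n, (-1) ^ j * Real.cos (m * (s - shiftedKnot n h (j : ℕ)))
        + Real.cos (n * (s - h))) := by
    intro j
    rw [lagrange, cos_degree_mul_sub_shiftedKnot hn, ← Finset.mul_sum]
    have : ((-1 : ℝ) ^ j) * (-1) ^ j = 1 := by rw [← mul_pow]; simp
    simp only [Nat.cast_zero, zero_mul, Real.cos_zero]
    linear_combination (1 / (2 * n) * Real.cos (n * (s - h))) * this
  simp only [e]
  rw [← Finset.mul_sum, Finset.sum_add_distrib, Finset.sum_add_distrib, ← Finset.mul_sum,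
    Finset.sum_comm, sum_alternating_cos_mul_sub_shiftedKnot h s (by omega),
    Finset.sum_eq_zero (s := Finset.Ico 1 n) fun m hm =>
      sum_alternating_cos_mul_sub_shiftedKnot h s (Finset.mem_Ico.1 hm).2]
  simp; field_simp

/-! ### The basis functions -/

/-- The Dirichlet kernel carries the frequency `n` with twice the weight it has in the Lagrange
kernel. The excess `cos (n (s - s_k^*))` depends on `k` only through a sign. -/
theorem basisFun_eq_lagrange {n : ℕ} (hn : 1 ≤ n) (h s : ℝ) (k : ℕ) :
    (2 * n + 1) * basisFun n h (k : ℕ) s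
      = 2 * n * lagrange n (s - shiftedKnot n h (k : ℕ)) + (-1) ^ k * Real.cos (n * (s - h)) := by
  have hn' : (n : ℝ) ≠ 0 := by positivity
  rw [← cos_degree_mul_sub_shiftedKnot hn, basisFun, lagrange,
    ← Finset.Ico_add_one_right_eq_Icc, Finset.sum_Ico_succ_top hn]
  generalize ∑ m ∈ Finset.Ico 1 n, Real.cos (m * (s - shiftedKnot n h (k : ℕ))) = S
  field_simp
  ring

theorem lagrange_node {n : ℕ} (hn : 1 ≤ n) (h : ℝ) {j k : ℕ} (hj : j < 2 * n) (hk : k < 2 * n) :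
    lagrange n (shiftedKnot n h (j : ℕ) - shiftedKnot n h (k : ℕ)) = if j = k then 1 else 0 := by
  have hn' : (0 : ℝ) < n := by exact_mod_cast hn
  have key : ∀ m : ℕ, 1 ≤ m → m < 2 * n → lagrange n (Real.pi * m / n) = 0 := by
    intro m hm hm'
    have hm0 : (0 : ℝ) < m := by exact_mod_cast hm
    have hm1 : (m : ℝ) < 2 * n := by exact_mod_cast hm'
    have hs : Real.sin (Real.pi * m / n / 2) ≠ 0 := by
      apply ne_of_gt
      apply Real.sin_pos_of_pos_of_lt_pi
      · have := Real.pi_pos; positivity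
      · rw [div_lt_iff₀ (by norm_num), div_lt_iff₀ hn']; nlinarith [Real.pi_pos]
    rw [lagrange_eq hn hs]
    have : (n : ℝ) * (Real.pi * m / n) = m * Real.pi := by field_simp
    rw [this, Real.sin_nat_mul_pi]; simp
  have e : shiftedKnot n h (j : ℕ) - shiftedKnot n h (k : ℕ) = Real.pi * ((j : ℝ) - k) / n := by
    simp only [shiftedKnot, knot]; push_cast; ring
  rw [e]
  rcases lt_trichotomy j k with hjk | hjk | hjk
  · rw [if_neg hjk.ne, ← lagrange_neg, ← key (k - j) (by omega) (by omega), Nat.cast_sub hjk.le]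
    congr 1; ring
  · subst hjk
    simp only [sub_self, mul_zero, zero_div, lagrange, Real.cos_zero, Finset.sum_const]
    simp [Nat.cast_sub hn]; field_simp; ring
  · rw [if_neg hjk.ne', ← key (j - k) (by omega) (by omega), Nat.cast_sub hjk.le]

/-- With `ε_j = (-1)^j`, the collocation matrix is `(2n I + ε εᵀ) / (2n + 1)`, a rank-one
perturbation of a scalar matrix. -/
theorem basisFun_node {n : ℕ} (hn : 1 ≤ n) (h : ℝ) {j k : ℕ} (hj : j < 2 * n) (hk : k < 2 * n) :
    (2 * n + 1) * basisFun n h (k : ℕ) (shiftedKnot n h (j : ℕ))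
      = (if j = k then 2 * (n : ℝ) else 0) + (-1) ^ k * (-1) ^ j := by
  have hn' : (n : ℝ) ≠ 0 := by positivity
  rw [basisFun_eq_lagrange hn, lagrange_node hn h hj hk]
  have : (n : ℝ) * (shiftedKnot n h (j : ℕ) - h) = (j : ℕ) * Real.pi := by
    simp only [shiftedKnot, knot]; push_cast; field_simp; ring
  rw [this, Real.cos_nat_mul_pi]
  split_ifs <;> simp

theorem basisFun_eq_sum_lagrange {n : ℕ} (hn : 1 ≤ n) (h s : ℝ) {k : ℕ} (hk : k < 2 * n) :
    basisFun n h (k : ℕ) s = ∑ j ∈ Finset.range (2 * n),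
      basisFun n h (k : ℕ) (shiftedKnot n h (j : ℕ)) * lagrange n (s - shiftedKnot n h (j : ℕ)) := by
  have hn' : (2 * (n : ℝ) + 1) ≠ 0 := by positivity
  apply mul_left_cancel₀ hn'
  rw [Finset.mul_sum]
  have : ∀ j ∈ Finset.range (2 * n), (2 * (n : ℝ) + 1) *
      (basisFun n h (k : ℕ) (shiftedKnot n h (j : ℕ)) * lagrange n (s - shiftedKnot n h (j : ℕ)))
      = (if j = k then 2 * n * lagrange n (s - shiftedKnot n h (j : ℕ)) else 0)
        + (-1) ^ k * ((-1) ^ j * lagrange n (s - shiftedKnot n h (j : ℕ))) := by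
    intro j hj
    rw [← mul_assoc, basisFun_node hn h (Finset.mem_range.1 hj) hk]
    split_ifs <;> ring
  rw [Finset.sum_congr rfl this, Finset.sum_add_distrib, ← Finset.mul_sum,
    sum_alternating_lagrange hn, Finset.sum_ite_eq', if_pos (Finset.mem_range.2 hk),
    basisFun_eq_lagrange hn]

/-- The approximate solution is the trigonometric interpolant of its nodal values. -/
theorem approxSol_eq_sum_lagrange {n : ℕ} (hn : 1 ≤ n) (h : ℝ) (c : Fin (2 * n) → ℂ) (s : ℝ) :
    approxSol n h c s = ∑ j : Fin (2 * n), approxSol n h c (shiftedKnot n h (j : ℕ))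
      * (lagrange n (s - shiftedKnot n h (j : ℕ)) : ℂ) := by
  simp only [approxSol, Finset.sum_mul]
  rw [Finset.sum_comm]
  refine Finset.sum_congr rfl fun k _ => ?_
  rw [basisFun_eq_sum_lagrange hn h s k.2, ← Fin.sum_univ_eq_sum_range (fun j : ℕ =>
    basisFun n h (k : ℕ) (shiftedKnot n h (j : ℕ)) * lagrange n (s - shiftedKnot n h (j : ℕ)))]
  push_cast
  rw [Finset.mul_sum]
  exact Finset.sum_congr rfl fun j _ => by ring

/-- The collocation matrix `ψ_k(s_j^*)`. -/
noncomputable def collocation (n : ℕ) (h : ℝ) : Matrix (Fin (2 * n)) (Fin (2 * n)) ℂ := fun j k =>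
  (basisFun n h (k : ℕ) (shiftedKnot n h (j : ℕ)) : ℂ)

/-- Pairing a null vector `c` with the alternating vector gives `4n w = 0` for `w = ∑ (-1)^k c_k`.
Each row then reduces to `2n c_j = 0`. Hence coefficients and nodal values determine each other. -/
theorem collocation_det_ne_zero {n : ℕ} (hn : 1 ≤ n) (h : ℝ) : (collocation n h).det ≠ 0 := by
  have hn' : (n : ℂ) ≠ 0 := by exact_mod_cast (by omega : n ≠ 0)
  intro hdet
  obtain ⟨c, hc, hc0⟩ := Matrix.exists_mulVec_eq_zero_iff.2 hdet
  set w : ℂ := ∑ k : Fin (2 * n), (-1) ^ (k : ℕ) * c k with hw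
  have hrow : ∀ j : Fin (2 * n), 2 * (n : ℂ) * c j + (-1) ^ (j : ℕ) * w = 0 := by
    intro j
    have h1 := congrFun hc0 j
    simp only [Matrix.mulVec, dotProduct, collocation, Pi.zero_apply] at h1
    have h2 : ∀ k : Fin (2 * n), (2 * (n : ℂ) + 1) *
        ((basisFun n h (k : ℕ) (shiftedKnot n h (j : ℕ)) : ℂ) * c k)
        = (if j = k then 2 * (n : ℂ) * c k else 0)
          + (-1) ^ (j : ℕ) * ((-1) ^ (k : ℕ) * c k) := by
      intro k
      have h3 := congrArg (fun r : ℝ => (r : ℂ)) (basisFun_node hn h j.2 k.2)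
      push_cast at h3
      rw [← mul_assoc, h3]
      simp only [Fin.ext_iff]
      split_ifs <;> push_cast <;> ring
    have h4 := congrArg (fun z => (2 * (n : ℂ) + 1) * z) h1
    simp only [Finset.mul_sum, h2, mul_zero] at h4
    rw [Finset.sum_add_distrib, ← Finset.mul_sum, Finset.sum_ite_eq, if_pos (Finset.mem_univ _),
      ← hw] at h4
    exact h4
  have hw0 : w = 0 := by
    have h1 : ∑ j : Fin (2 * n), (-1) ^ (j : ℕ) * (2 * (n : ℂ) * c j + (-1) ^ (j : ℕ) * w) = 0 := by
      simp [hrow]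
    have h2 : ∀ j : Fin (2 * n), (-1) ^ (j : ℕ) * (2 * (n : ℂ) * c j + (-1) ^ (j : ℕ) * w)
        = 2 * (n : ℂ) * ((-1) ^ (j : ℕ) * c j) + w := by
      intro j
      have : ((-1 : ℂ) ^ (j : ℕ)) * (-1) ^ (j : ℕ) = 1 := by rw [← mul_pow]; simp
      linear_combination w * this
    simp only [h2, Finset.sum_add_distrib, ← Finset.mul_sum, ← hw, Finset.sum_const,
      Finset.card_univ, Fintype.card_fin, nsmul_eq_mul] at h1
    push_cast at h1
    have h3 : (4 * (n : ℂ)) * w = 0 := by linear_combination h1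
    exact (mul_eq_zero.1 h3).resolve_left (mul_ne_zero (by norm_num) hn')
  apply hc
  funext j
  have h1 := hrow j
  rw [hw0, mul_zero, add_zero] at h1
  exact (mul_eq_zero.1 h1).resolve_left (mul_ne_zero two_ne_zero hn')

/-! ### Error of trigonometric interpolation -/

theorem pi_rpow_le {α : ℝ} (hα1 : α ≤ 1) : Real.pi ^ α ≤ Real.pi := by
  have h : (1 : ℝ) ≤ Real.pi := by linarith [Real.pi_gt_three]
  simpa using Real.rpow_le_rpow_of_exponent_le h hα1

theorem pi_div_rpow_le {α : ℝ} (hα1 : α ≤ 1) (n : ℕ) :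
    (Real.pi / n) ^ α ≤ Real.pi / (n : ℝ) ^ α := by
  rw [Real.div_rpow Real.pi_pos.le (Nat.cast_nonneg n)]
  gcongr
  exact pi_rpow_le hα1

/-- By periodicity the Hölder bound may be measured along the shorter arc, hence by the chord `sin
w`. This is needed because the nodes run once round the circle, so that `t - s` may be close to
`2π`. -/
theorem IsHolder.norm_sub_le_sin {α M : ℝ} {x : ℝ → ℂ} (hα : 0 < α) (hα1 : α ≤ 1)
    (hx : IsHolder α M x) {s t w : ℝ} (hw0 : 0 < w) (hw1 : w < Real.pi) (hst : t - s = 2 * w) :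
    ‖x s - x t‖ ≤ M * Real.pi * Real.sin w ^ α := by
  have hM := hx.const_nonneg
  have key : ∀ v : ℝ, 0 < v → v ≤ Real.pi / 2 → M * (2 * v) ^ α ≤ M * Real.pi * Real.sin v ^ α := by
    intro v hv hv'
    have h1 := Real.mul_le_sin hv.le hv'
    have h2 : 2 * v ≤ Real.pi * Real.sin v := by
      have : Real.pi * (2 / Real.pi * v) = 2 * v := by field_simp
      nlinarith [Real.pi_pos]
    have hs : 0 ≤ Real.sin v := le_trans (by positivity) h1
    calc M * (2 * v) ^ α ≤ M * (Real.pi * Real.sin v) ^ α := by gcongr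
      _ = M * (Real.pi ^ α * Real.sin v ^ α) := by rw [Real.mul_rpow Real.pi_pos.le hs]
      _ ≤ M * (Real.pi * Real.sin v ^ α) := by gcongr; exact pi_rpow_le hα1
      _ = _ := by ring
  rcases le_total w (Real.pi / 2) with h | h
  · refine (hx.2 s t).trans ?_
    rw [abs_sub_comm, hst, abs_of_pos (by linarith)]
    exact key w hw0 h
  · have h1 := hx.2 s (t - 2 * Real.pi)
    rw [hx.1.sub_eq] at h1
    refine h1.trans ?_
    have : s - (t - 2 * Real.pi) = 2 * (Real.pi - w) := by linarith
    rw [this, abs_of_pos (by linarith)]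
    simpa [Real.sin_pi_sub] using key (Real.pi - w) (by linarith) (by linarith)

theorem exists_shiftedKnot_le {n : ℕ} (hn : 1 ≤ n) (h s : ℝ) :
    ∃ (j : ℤ) (θ : ℝ), 0 ≤ θ ∧ θ < Real.pi / n ∧ s = shiftedKnot n h j + θ := by
  have hn' : (0 : ℝ) < n := by exact_mod_cast hn
  have hd : 0 < Real.pi / n := by have := Real.pi_pos; positivity
  refine ⟨⌊(s - h) / (Real.pi / n)⌋, s - shiftedKnot n h ⌊(s - h) / (Real.pi / n)⌋, ?_, ?_, by ring⟩
  · have := Int.floor_le ((s - h) / (Real.pi / n))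
    rw [le_div_iff₀ hd] at this
    simp only [shiftedKnot, knot]
    have e : Real.pi * (⌊(s - h) / (Real.pi / n)⌋ : ℝ) / n
      = ⌊(s - h) / (Real.pi / n)⌋ * (Real.pi / n) := by ring
    rw [e]; linarith
  · have := Int.lt_floor_add_one ((s - h) / (Real.pi / n))
    rw [div_lt_iff₀ hd] at this
    simp only [shiftedKnot, knot]
    have e : Real.pi * (⌊(s - h) / (Real.pi / n)⌋ : ℝ) / n
      = ⌊(s - h) / (Real.pi / n)⌋ * (Real.pi / n) := by ring
    rw [e]; linarith

theorem sub_shiftedKnot_add (n : ℕ) (h θ : ℝ) (j : ℤ) (i : ℕ) :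
    shiftedKnot n h j + θ - shiftedKnot n h (j + i) = -(2 * (Real.pi * i / (2 * n) - θ / 2)) := by
  rw [shiftedKnot_add]; push_cast; ring

/-- Half the distance from `s_0^* + θ`, `0 ≤ θ < π/n`, to the `i`-th following node. -/
theorem half_distance_bounds {n i : ℕ} {θ : ℝ} (hθ : 0 ≤ θ) (hθ' : θ < Real.pi / n)
    (hi : 2 ≤ i) (hi' : i < 2 * n) :
    0 < Real.pi * i / (2 * n) - θ / 2 ∧ Real.pi * i / (2 * n) - θ / 2 < Real.pi ∧
    1 / Real.sin (Real.pi * i / (2 * n) - θ / 2)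
      ≤ n * (1 / ((i : ℝ) - 1) + 1 / (2 * n - i)) := by
  have hpi := Real.pi_pos
  have hn : (0 : ℝ) < n := by exact_mod_cast (by omega : 0 < n)
  have hi1 : (2 : ℝ) ≤ i := by exact_mod_cast hi
  have hi2 : (i : ℝ) + 1 ≤ 2 * n := by exact_mod_cast hi'
  have a1 : Real.pi * (i - 1) / (2 * n) < Real.pi * i / (2 * n) - θ / 2 := by
    have : Real.pi * (i - 1) / (2 * n) = Real.pi * i / (2 * n) - Real.pi / n / 2 := by field_simp
    linarith
  have a2 : Real.pi * (2 * n - i) / (2 * n) ≤ Real.pi - (Real.pi * i / (2 * n) - θ / 2) := by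
    have : Real.pi * (2 * n - i) / (2 * n) = Real.pi - Real.pi * i / (2 * n) := by field_simp
    linarith
  have b1 : 0 < Real.pi * (i - 1) / (2 * n) := by
    have : (0 : ℝ) < i - 1 := by linarith
    positivity
  have b2 : 0 < Real.pi * (2 * n - i) / (2 * n) := by
    have : (0 : ℝ) < 2 * n - i := by linarith
    positivity
  have c1 : (0 : ℝ) < i - 1 := by linarith
  have c2 : (0 : ℝ) < 2 * n - i := by linarith
  refine ⟨by linarith, by linarith, (inv_sin_le (by linarith) (by linarith)).trans ?_⟩
  calc Real.pi / 2 * (1 / (Real.pi * i / (2 * n) - θ / 2)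
        + 1 / (Real.pi - (Real.pi * i / (2 * n) - θ / 2)))
      ≤ Real.pi / 2 * (1 / (Real.pi * (i - 1) / (2 * n)) + 1 / (Real.pi * (2 * n - i) / (2 * n))) := by
        gcongr
    _ = n * (1 / ((i : ℝ) - 1) + 1 / (2 * n - i)) := by field_simp

/-- At all nodes the factor `sin (nt)` has the same modulus and alternating sign; only the cotangent
varies in size. -/
theorem lagrange_at_node_distance {n i : ℕ} {θ : ℝ} (hθ : 0 ≤ θ) (hθ' : θ < Real.pi / n)
    (hi : 2 ≤ i) (hi' : i < 2 * n) :
    lagrange n (-(2 * (Real.pi * i / (2 * n) - θ / 2)))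
      = -(-1) ^ i * (Real.sin (n * θ) / (2 * n)
        * Real.cot (Real.pi * i / (2 * n) - θ / 2)) := by
  have hn : (n : ℝ) ≠ 0 := by exact_mod_cast (by omega : n ≠ 0)
  obtain ⟨h0, h1, -⟩ := half_distance_bounds hθ hθ' hi hi'
  have e1 : ∀ u : ℝ, 2 * u / 2 = u := fun u => by ring
  rw [lagrange_neg, lagrange_eq (by omega)
    (by rw [e1]; exact (Real.sin_pos_of_pos_of_lt_pi h0 h1).ne'), e1]
  have e2 : (n : ℝ) * (2 * (Real.pi * i / (2 * n) - θ / 2)) = (i : ℕ) * Real.pi - n * θ := by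
    field_simp
  rw [e2, Real.sin_nat_mul_pi_sub]
  ring

/-- The Lebesgue constant. The two nodes enclosing `s` contribute at most `1` each, and the others a
harmonic sum; each share is at most `4 log n`. -/
theorem sum_abs_lagrange_le {n : ℕ} (hn : 2 ≤ n) (h s : ℝ) :
    ∑ j : Fin (2 * n), |lagrange n (s - shiftedKnot n h (j : ℕ))| ≤ 8 * Real.log n := by
  obtain ⟨j, θ, hθ, hθ', rfl⟩ := exists_shiftedKnot_le (by omega : 1 ≤ n) h s
  have hn0 : (0 : ℝ) < n := by exact_mod_cast (by omega : 0 < n)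
  rw [sum_fin_eq_sum_range_shift (F := fun k : ℤ => |lagrange n (shiftedKnot n h j + θ
    - shiftedKnot n h k)|) (j := j)]
  swap
  · intro k
    rw [shiftedKnot_add_period (by omega), ← sub_sub, (lagrange_periodic n).sub_eq]
  simp only [sub_shiftedKnot_add]
  obtain ⟨m, hm⟩ : ∃ m, 2 * n = m + 2 := ⟨2 * n - 2, by omega⟩
  rw [hm, Finset.sum_range_succ', Finset.sum_range_succ']
  have hb : ∀ r ∈ Finset.range m,
      |lagrange n (-(2 * (Real.pi * ((r + 1 + 1 : ℕ) : ℝ) / (2 * n) - θ / 2)))|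
      ≤ 1 / 2 * (1 / ((r : ℝ) + 1) + 1 / ((m : ℝ) - r)) := by
    intro r hr
    have hr' := Finset.mem_range.1 hr
    have hi' : r + 1 + 1 < 2 * n := by omega
    obtain ⟨h0, h1, h2⟩ := half_distance_bounds hθ hθ' (by omega : 2 ≤ r + 1 + 1) hi'
    rw [lagrange_at_node_distance hθ hθ' (by omega) hi', abs_mul, abs_neg, abs_pow, abs_neg,
      abs_one, one_pow, one_mul, abs_mul, abs_div, abs_of_pos (by positivity : (0 : ℝ) < 2 * n)]
    have h3 := (abs_cot_le_inv_sin h0 h1).trans h2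
    have hmc : (2 * n : ℝ) = m + 2 := by exact_mod_cast hm
    have e : (n : ℝ) * (1 / (((r + 1 + 1 : ℕ) : ℝ) - 1) + 1 / (2 * n - ((r + 1 + 1 : ℕ) : ℝ)))
        = n * (1 / ((r : ℝ) + 1) + 1 / ((m : ℝ) - r)) := by
      rw [hmc]; push_cast; congr 3 <;> ring
    rw [e] at h3
    calc _ ≤ 1 / (2 * n) * (n * (1 / ((r : ℝ) + 1) + 1 / ((m : ℝ) - r))) := by
          gcongr
          exact Real.abs_sin_le_one _
      _ = _ := by field_simp
  have hsum := Finset.sum_le_sum hb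
  rw [← Finset.mul_sum] at hsum
  have h1 := sum_inv_add_inv_reflect_le (by omega : m ≤ 2 * n)
  have h2 := one_add_log_two_mul_le hn
  have h3 := half_le_log hn
  have h4 := abs_lagrange_le_one (by omega : 1 ≤ n)
    (-(2 * (Real.pi * ((0 + 1 : ℕ) : ℝ) / (2 * n) - θ / 2)))
  have h5 := abs_lagrange_le_one (by omega : 1 ≤ n) (-(2 * (Real.pi * ((0 : ℕ) : ℝ) / (2 * n) - θ / 2)))
  linarith

theorem cot_sub_cot {u v : ℝ} (hu : Real.sin u ≠ 0) (hv : Real.sin v ≠ 0) :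
    Real.cot u - Real.cot v = Real.sin (v - u) / (Real.sin u * Real.sin v) := by
  rw [Real.cot_eq_cos_div_sin, Real.cot_eq_cos_div_sin, Real.sin_sub]
  field_simp

theorem sum_range_two_mul {β : Type*} [AddCommMonoid β] (F : ℕ → β) (m : ℕ) :
    ∑ i ∈ Finset.range (2 * m), F i = ∑ r ∈ Finset.range m, (F (2 * r) + F (2 * r + 1)) := by
  induction m with
  | zero => simp
  | succ m ih =>
    rw [Finset.sum_range_succ, ← ih, mul_add, mul_one, Finset.sum_range_succ,
      Finset.sum_range_succ, add_assoc]

/-- Termwise bounds of `(x(s) - x(s_i^*)) ℓ_i(s)` do not sum to something small. Adjacent kernels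
have opposite signs, so a pair leaves one difference of `x` between neighbouring nodes and one
difference of neighbouring cotangents. Each gains a factor `n^{-α}`. -/
theorem norm_adjacent_pair_le {α M : ℝ} {x : ℝ → ℂ} (hα : 0 < α) (hα1 : α ≤ 1)
    (hx : IsHolder α M x) {n i : ℕ} (h : ℝ) (j : ℤ) {θ : ℝ} (hθ : 0 ≤ θ) (hθ' : θ < Real.pi / n)
    (hi : 2 ≤ i) (hi' : i + 1 < 2 * n) (hie : Even i) :
    ‖(x (shiftedKnot n h j + θ) - x (shiftedKnot n h (j + i)))
        * (lagrange n (-(2 * (Real.pi * i / (2 * n) - θ / 2))) : ℂ)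
      + (x (shiftedKnot n h j + θ) - x (shiftedKnot n h (j + (i + 1 : ℕ))))
        * (lagrange n (-(2 * (Real.pi * (i + 1 : ℕ) / (2 * n) - θ / 2))) : ℂ)‖
      ≤ M * Real.pi ^ 2 / (n : ℝ) ^ α * (1 / ((i : ℝ) - 1) + 1 / (2 * n - i)) := by
  have hpi := Real.pi_pos
  have hM := hx.const_nonneg
  have hn : (0 : ℝ) < n := by exact_mod_cast (by omega : 0 < n)
  obtain ⟨u0, u1, u2⟩ := half_distance_bounds hθ hθ' hi (by omega : i < 2 * n)
  obtain ⟨w0, w1, w2⟩ := half_distance_bounds hθ hθ' (by omega : 2 ≤ i + 1) hi'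
  rw [lagrange_at_node_distance hθ hθ' hi (by omega),
    lagrange_at_node_distance hθ hθ' (by omega) hi', pow_succ, hie.neg_one_pow]
  have hxw := hx.norm_sub_le_sin hα hα1 (s := shiftedKnot n h j + θ)
    (t := shiftedKnot n h (j + (i + 1 : ℕ))) w0 w1 (by
      have := sub_shiftedKnot_add n h θ j (i + 1)
      linarith)
  have hvv : ‖x (shiftedKnot n h (j + i)) - x (shiftedKnot n h (j + (i + 1 : ℕ)))‖
      ≤ M * (Real.pi / (n : ℝ) ^ α) := by
    refine (hx.2 _ _).trans ?_
    have : shiftedKnot n h (j + i) - shiftedKnot n h (j + (i + 1 : ℕ)) = -(Real.pi / n) := by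
      rw [shiftedKnot_add, shiftedKnot_add]; push_cast; ring
    rw [this, abs_neg, abs_of_pos (by positivity)]
    gcongr
    exact pi_div_rpow_le hα1 n
  have hwu : (Real.pi * (i + 1 : ℕ) / (2 * n) - θ / 2) - (Real.pi * i / (2 * n) - θ / 2)
      = Real.pi / (2 * n) := by push_cast; field_simp; ring
  set u := Real.pi * i / (2 * n) - θ / 2
  set w := Real.pi * (i + 1 : ℕ) / (2 * n) - θ / 2
  set X := x (shiftedKnot n h j + θ)
  set v := x (shiftedKnot n h (j + i))
  set v' := x (shiftedKnot n h (j + (i + 1 : ℕ)))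
  set β : ℝ := 1 / ((i : ℝ) - 1) + 1 / (2 * n - i) with hβ
  have hi1 : (2 : ℝ) ≤ i := by exact_mod_cast hi
  have hi2 : (i : ℝ) + 2 ≤ 2 * n := by exact_mod_cast hi'
  have hβ0 : 0 ≤ β := add_nonneg (one_div_nonneg.2 (by linarith)) (one_div_nonneg.2 (by linarith))
  have su := Real.sin_pos_of_pos_of_lt_pi u0 u1
  have sw := Real.sin_pos_of_pos_of_lt_pi w0 w1
  have hNα : 0 < (n : ℝ) ^ α := Real.rpow_pos_of_pos hn α
  have hwinv : (1 / Real.sin w) ≤ 2 * n := by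
    refine w2.trans ?_
    have e1 : 1 / (((i + 1 : ℕ) : ℝ) - 1) ≤ 1 := by
      rw [div_le_one] <;> push_cast <;> linarith
    have e2 : 1 / (2 * (n : ℝ) - ((i + 1 : ℕ) : ℝ)) ≤ 1 := by
      rw [div_le_one] <;> push_cast <;> linarith
    nlinarith
  -- Trades the growth of `|X - v'|` against the decay of the cotangent difference: `sin^{α-1} w ≤
  -- (2n)^{1-α}`, as `sin w` is at least `1/(2n)`.
  have hwpow : Real.sin w ^ α * (1 / Real.sin w) ≤ 2 * (n / (n : ℝ) ^ α) := by
    have e1 : Real.sin w ^ α * (1 / Real.sin w) = (1 / Real.sin w) ^ (1 - α) := by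
      rw [Real.rpow_sub (by positivity), Real.rpow_one, Real.div_rpow zero_le_one sw.le,
        Real.one_rpow]
      field_simp
    rw [e1]
    calc (1 / Real.sin w) ^ (1 - α) ≤ (2 * n : ℝ) ^ (1 - α) :=
          Real.rpow_le_rpow (by positivity) hwinv (by linarith)
      _ = (2 : ℝ) ^ (1 - α) * (n / (n : ℝ) ^ α) := by
          rw [Real.mul_rpow (by norm_num) hn.le, Real.rpow_sub hn, Real.rpow_one]
      _ ≤ 2 * (n / (n : ℝ) ^ α) := by
          gcongr
          have := Real.rpow_le_rpow_of_exponent_le (by norm_num : (1 : ℝ) ≤ 2)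
            (by linarith : 1 - α ≤ 1)
          simpa using this
  have hcu : |Real.cot u| ≤ n * β := (abs_cot_le_inv_sin u0 u1).trans u2
  have hcc : |Real.cot u - Real.cot w| ≤ Real.pi / (2 * n) * (1 / Real.sin u * (1 / Real.sin w)) := by
    rw [cot_sub_cot su.ne' sw.ne', hwu, abs_div, abs_of_pos (mul_pos su sw)]
    have : |Real.sin (Real.pi / (2 * n))| ≤ Real.pi / (2 * n) := by
      have := Real.abs_sin_le_abs (x := Real.pi / (2 * n))
      rwa [abs_of_pos (by positivity : 0 < Real.pi / (2 * n))] at this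
    calc _ ≤ Real.pi / (2 * n) / (Real.sin u * Real.sin w) := by gcongr
      _ = _ := by field_simp
  have hsin : |Real.sin (n * θ)| ≤ 1 := Real.abs_sin_le_one _
  -- Summation by parts on two terms: `v - v'` multiplies `cot u`, and `X - v'` multiplies `cot u -
  -- cot w`.
  have alg : (X - v) * ((-(1 : ℝ) * (Real.sin (n * θ) / (2 * n) * Real.cot u) : ℝ) : ℂ)
      + (X - v') * ((-((1 : ℝ) * -1) * (Real.sin (n * θ) / (2 * n) * Real.cot w) : ℝ) : ℂ)
      = ((Real.sin (n * θ) / (2 * n) : ℝ) : ℂ) *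
        ((v - v') * (Real.cot u : ℂ) - (X - v') * ((Real.cot u - Real.cot w : ℝ) : ℂ)) := by
    push_cast; ring
  rw [alg, norm_mul, Complex.norm_real, Real.norm_eq_abs, abs_div,
    abs_of_pos (by positivity : (0 : ℝ) < 2 * n)]
  have t1 : ‖(v - v') * (Real.cot u : ℂ)‖ ≤ M * (Real.pi / (n : ℝ) ^ α) * (n * β) := by
    rw [norm_mul, Complex.norm_real, Real.norm_eq_abs]
    exact mul_le_mul hvv hcu (abs_nonneg _) (by positivity)
  have t2 : ‖(X - v') * ((Real.cot u - Real.cot w : ℝ) : ℂ)‖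
      ≤ M * Real.pi ^ 2 * (1 / (n : ℝ) ^ α) * (n * β) := by
    rw [norm_mul, Complex.norm_real, Real.norm_eq_abs]
    calc _ ≤ M * Real.pi * Real.sin w ^ α
          * (Real.pi / (2 * n) * (1 / Real.sin u * (1 / Real.sin w))) :=
          mul_le_mul hxw hcc (abs_nonneg _) (by positivity)
      _ = M * Real.pi * (Real.pi / (2 * n)) * (1 / Real.sin u)
          * (Real.sin w ^ α * (1 / Real.sin w)) := by ring
      _ ≤ M * Real.pi * (Real.pi / (2 * n)) * (n * β) * (2 * (n / (n : ℝ) ^ α)) := by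
          gcongr
      _ = _ := by field_simp
  have t3 : M * (Real.pi / (n : ℝ) ^ α) * (n * β) ≤ M * Real.pi ^ 2 * (1 / (n : ℝ) ^ α) * (n * β) := by
    have : Real.pi ≤ Real.pi ^ 2 := by nlinarith [Real.pi_gt_three]
    calc M * (Real.pi / (n : ℝ) ^ α) * (n * β) = M * Real.pi * (1 / (n : ℝ) ^ α) * (n * β) := by ring
      _ ≤ _ := by gcongr
  calc _ ≤ 1 / (2 * n) * (M * Real.pi ^ 2 * (1 / (n : ℝ) ^ α) * (n * β)
        + M * Real.pi ^ 2 * (1 / (n : ℝ) ^ α) * (n * β)) := by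
        gcongr
        exact (norm_sub_le _ _).trans (add_le_add (t1.trans t3) t2)
    _ = _ := by field_simp; ring

/-- Trigonometric interpolation of a Hölder function at `2n` equidistant nodes. -/
theorem norm_sum_sub_mul_lagrange_le {α M : ℝ} {x : ℝ → ℂ} (hα : 0 < α) (hα1 : α ≤ 1)
    (hx : IsHolder α M x) {n : ℕ} (hn : 2 ≤ n) (h s : ℝ) :
    ‖∑ k : Fin (2 * n), (x s - x (shiftedKnot n h (k : ℕ)))
        * (lagrange n (s - shiftedKnot n h (k : ℕ)) : ℂ)‖
      ≤ 12 * Real.pi ^ 2 * M * Real.log n / (n : ℝ) ^ α := by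
  obtain ⟨j, θ, hθ, hθ', rfl⟩ := exists_shiftedKnot_le (by omega : 1 ≤ n) h s
  have hpi := Real.pi_pos
  have hM := hx.const_nonneg
  have hn0 : (0 : ℝ) < n := by exact_mod_cast (by omega : 0 < n)
  have hNα : 0 < (n : ℝ) ^ α := Real.rpow_pos_of_pos hn0 α
  rw [sum_fin_eq_sum_range_shift (F := fun k : ℤ => (x (shiftedKnot n h j + θ)
    - x (shiftedKnot n h k)) * (lagrange n (shiftedKnot n h j + θ - shiftedKnot n h k) : ℂ)) (j := j)]
  swap
  · intro k
    rw [shiftedKnot_add_period (by omega), ← sub_sub, (lagrange_periodic n).sub_eq, hx.1]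
  simp only [sub_shiftedKnot_add]
  have near : ∀ i : ℕ, i ≤ 1 → ‖(x (shiftedKnot n h j + θ) - x (shiftedKnot n h (j + i)))
      * (lagrange n (-(2 * (Real.pi * i / (2 * n) - θ / 2))) : ℂ)‖
      ≤ M * (Real.pi / (n : ℝ) ^ α) := by
    intro i hi
    rw [norm_mul, Complex.norm_real, Real.norm_eq_abs]
    have h1 : ‖x (shiftedKnot n h j + θ) - x (shiftedKnot n h (j + i))‖
        ≤ M * (Real.pi / (n : ℝ) ^ α) := by
      refine (hx.2 _ _).trans ?_
      rw [sub_shiftedKnot_add]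
      have : |-(2 * (Real.pi * i / (2 * n) - θ / 2))| ≤ Real.pi / n := by
        have e : -(2 * (Real.pi * i / (2 * n) - θ / 2)) = θ - Real.pi / n * i := by field_simp; ring
        rw [e, abs_le]
        interval_cases i
        · simp; constructor <;> linarith
        · simp; constructor <;> linarith
      calc _ ≤ M * (Real.pi / n) ^ α := by gcongr
        _ ≤ _ := by gcongr; exact pi_div_rpow_le hα1 n
    calc _ ≤ M * (Real.pi / (n : ℝ) ^ α) * 1 :=
          mul_le_mul h1 (abs_lagrange_le_one (by omega) _) (abs_nonneg _) (by positivity)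
      _ = _ := mul_one _
  obtain ⟨m, rfl⟩ : ∃ m, n = m + 1 := ⟨n - 1, by omega⟩
  -- The two nodes enclosing `s` are split off; the other `2m = 2n - 2` are grouped in pairs whose
  -- first offset `2r + 2` is even.
  rw [mul_add, mul_one, Finset.sum_range_succ', Finset.sum_range_succ', sum_range_two_mul]
  have pair : ∀ r ∈ Finset.range m, ‖(x (shiftedKnot (m + 1) h j + θ)
        - x (shiftedKnot (m + 1) h (j + (2 * r + 1 + 1 : ℕ))))
        * (lagrange (m + 1)
          (-(2 * (Real.pi * (2 * r + 1 + 1 : ℕ) / (2 * (m + 1 : ℕ)) - θ / 2))) : ℂ)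
      + (x (shiftedKnot (m + 1) h j + θ)
        - x (shiftedKnot (m + 1) h (j + (2 * r + 1 + 1 + 1 : ℕ))))
        * (lagrange (m + 1)
          (-(2 * (Real.pi * (2 * r + 1 + 1 + 1 : ℕ) / (2 * (m + 1 : ℕ)) - θ / 2))) : ℂ)‖
      ≤ M * Real.pi ^ 2 / ((m + 1 : ℕ) : ℝ) ^ α * (1 / ((r : ℝ) + 1) + 1 / ((m : ℝ) - r)) := by
    intro r hr
    have hr' : r + 1 ≤ m := Finset.mem_range.1 hr
    have hr2 : (r : ℝ) + 1 ≤ m := by exact_mod_cast hr'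
    refine (norm_adjacent_pair_le hα hα1 hx h j hθ hθ' (by omega : 2 ≤ 2 * r + 1 + 1)
      (by omega) ⟨r + 1, by omega⟩).trans ?_
    have hr0 : (0 : ℝ) ≤ r := Nat.cast_nonneg r
    gcongr ?_ * (?_ + ?_)
    · refine one_div_le_one_div_of_le (by positivity) ?_
      push_cast; linarith
    · refine one_div_le_one_div_of_le (by linarith) ?_
      push_cast; linarith
  refine (norm_add_le _ _).trans ((add_le_add_left (norm_add_le _ _) _).trans ?_)
  have hS := (norm_sum_le _ _).trans (Finset.sum_le_sum pair)
  rw [← Finset.mul_sum] at hS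
  have h1 := sum_inv_add_inv_reflect_le (by omega : m ≤ 2 * (m + 1))
  have h2 := one_add_log_two_mul_le hn
  have h3 := half_le_log hn
  have n0 := near 0 (by norm_num)
  have n1 := near (0 + 1) (by norm_num)
  set N := ((m + 1 : ℕ) : ℝ) ^ α
  set L := Real.log ((m + 1 : ℕ) : ℝ)
  have hS2 := hS.trans (mul_le_mul_of_nonneg_left
    (h1.trans (by linarith : _ ≤ 8 * L)) (by positivity : 0 ≤ M * Real.pi ^ 2 / N))
  -- The two split-off terms have no logarithm; `1 ≤ 2L` supplies it. The constant is `12 = 8 + 2 +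
  -- 2`.
  have e3 : M * (Real.pi / N) ≤ M * (2 * L * Real.pi ^ 2 / N) := by
    gcongr
    nlinarith [Real.pi_gt_three, mul_nonneg (by linarith : 0 ≤ 2 * L - 1) (sq_nonneg Real.pi)]
  have e4 : 12 * Real.pi ^ 2 * M * L / N
      = M * Real.pi ^ 2 / N * (8 * L) + M * (2 * L * Real.pi ^ 2 / N)
        + M * (2 * L * Real.pi ^ 2 / N) := by ring
  rw [e4]
  exact add_le_add (add_le_add hS2 (n1.trans e3)) (n0.trans e3)

/-! ### Integrals against the Hilbert kernel -/

theorem cot_sub_pi (u : ℝ) : Real.cot (u - Real.pi) = Real.cot u := by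
  rw [Real.cot_eq_cos_div_sin, Real.cot_eq_cos_div_sin, Real.cos_sub_pi, Real.sin_sub_pi, neg_div_neg_eq]

theorem cot_pi_sub (u : ℝ) : Real.cot (Real.pi - u) = -Real.cot u := by
  rw [Real.cot_eq_cos_div_sin, Real.cot_eq_cos_div_sin, Real.cos_pi_sub, Real.sin_pi_sub, neg_div]

theorem sin_half_pos {t : ℝ} (ht : t ∈ Set.Ioo 0 (2 * Real.pi)) : 0 < Real.sin (t / 2) :=
  Real.sin_pos_of_pos_of_lt_pi (by linarith [ht.1]) (by linarith [ht.2])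

theorem continuousOn_cot_half :
    ContinuousOn (fun t : ℝ => Real.cot (t / 2)) (Set.Ioo 0 (2 * Real.pi)) := by
  simp only [Real.cot_eq_cos_div_sin]
  refine ContinuousOn.div (by fun_prop) (by fun_prop) fun t ht => (sin_half_pos ht).ne'

theorem intervalIntegrable_cot_half {p q : ℝ} (hp : 0 < p) (hq : q < 2 * Real.pi) (hpq : p ≤ q) :
    IntervalIntegrable (fun t : ℝ => Real.cot (t / 2)) MeasureTheory.volume p q := by
  apply ContinuousOn.intervalIntegrable
  rw [Set.uIcc_of_le hpq]
  exact continuousOn_cot_half.mono fun t ht => ⟨hp.trans_le ht.1, ht.2.trans_lt hq⟩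

theorem intervalIntegrable_mul_cot_half {y : ℝ → ℂ} (hy : Continuous y) {p q : ℝ} (hp : 0 < p)
    (hq : q < 2 * Real.pi) (hpq : p ≤ q) :
    IntervalIntegrable (fun t : ℝ => y t * (Real.cot (t / 2) : ℂ)) MeasureTheory.volume p q := by
  apply ContinuousOn.intervalIntegrable
  rw [Set.uIcc_of_le hpq]
  refine hy.continuousOn.mul (Complex.continuous_ofReal.comp_continuousOn ?_)
  exact continuousOn_cot_half.mono fun t ht => ⟨hp.trans_le ht.1, ht.2.trans_lt hq⟩

theorem integral_cot_half {p q : ℝ} (hp : 0 < p) (hq : q < 2 * Real.pi) (hpq : p ≤ q) :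
    ∫ t in p..q, Real.cot (t / 2)
      = 2 * Real.log (Real.sin (q / 2)) - 2 * Real.log (Real.sin (p / 2)) := by
  rw [intervalIntegral.integral_eq_sub_of_hasDerivAt
    (f := fun t => 2 * Real.log (Real.sin (t / 2))) ?_ (intervalIntegrable_cot_half hp hq hpq)]
  intro t ht
  rw [Set.uIcc_of_le hpq] at ht
  have hs := sin_half_pos ⟨hp.trans_le ht.1, ht.2.trans_lt hq⟩
  have h1 : HasDerivAt (fun t : ℝ => t / 2) (1 / 2) t := (hasDerivAt_id t).div_const 2
  have h2 := ((h1.sin).log hs.ne').const_mul 2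
  refine h2.congr_deriv ?_
  rw [Real.cot_eq_cos_div_sin]
  field_simp

theorem integral_mul_cot_translate (y : ℝ → ℂ) (c a b : ℝ) :
    ∫ σ in a..b, y σ * (Real.cot ((σ - c) / 2) : ℂ)
      = ∫ t in (a - c)..(b - c), y (c + t) * (Real.cot (t / 2) : ℂ) := by
  rw [← intervalIntegral.integral_comp_sub_right
    (fun t => y (c + t) * (Real.cot (t / 2) : ℂ)) c]
  simp only [add_sub_cancel]

theorem integral_cot_translate (c a b : ℝ) :
    ∫ σ in a..b, Real.cot ((σ - c) / 2) = ∫ t in (a - c)..(b - c), Real.cot (t / 2) :=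
  intervalIntegral.integral_comp_sub_right (fun t => Real.cot (t / 2)) c

theorem integral_mul_cot_sub_period (y : ℝ → ℂ) (p q : ℝ) :
    ∫ t in (p - 2 * Real.pi)..(q - 2 * Real.pi), y t * (Real.cot (t / 2) : ℂ)
      = ∫ t in p..q, y (t - 2 * Real.pi) * (Real.cot (t / 2) : ℂ) := by
  rw [← intervalIntegral.integral_comp_sub_right (fun t => y t * (Real.cot (t / 2) : ℂ))]
  have : ∀ t : ℝ, (t - 2 * Real.pi) / 2 = t / 2 - Real.pi := fun t => by ring
  simp only [this, cot_sub_pi]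

theorem integral_cot_sub_period (p q : ℝ) :
    ∫ t in (p - 2 * Real.pi)..(q - 2 * Real.pi), Real.cot (t / 2)
      = ∫ t in p..q, Real.cot (t / 2) := by
  rw [← intervalIntegral.integral_comp_sub_right (fun t => Real.cot (t / 2))]
  have : ∀ t : ℝ, (t - 2 * Real.pi) / 2 = t / 2 - Real.pi := fun t => by ring
  simp only [this, cot_sub_pi]

/-- The cotangent of the half angle is odd about `π`, so estimates near `2π` reduce to estimates
near `0`. -/
theorem integral_mul_cot_reflect (y : ℝ → ℂ) (p q : ℝ) :
    ∫ t in (2 * Real.pi - q)..(2 * Real.pi - p), y t * (Real.cot (t / 2) : ℂ)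
      = -∫ t in p..q, y (2 * Real.pi - t) * (Real.cot (t / 2) : ℂ) := by
  rw [← intervalIntegral.integral_comp_sub_left (fun t => y t * (Real.cot (t / 2) : ℂ)),
    ← intervalIntegral.integral_neg]
  have : ∀ t : ℝ, (2 * Real.pi - t) / 2 = Real.pi - t / 2 := fun t => by ring
  simp only [this, cot_pi_sub, Complex.ofReal_neg, mul_neg]

theorem abs_cot_half_le {t : ℝ} (h0 : 0 < t) (h1 : t ≤ Real.pi) : |Real.cot (t / 2)| ≤ Real.pi / t := by
  have hpi := Real.pi_pos
  refine (abs_cot_le_inv_sin (by linarith) (by linarith)).trans ?_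
  have := Real.mul_le_sin (by linarith : 0 ≤ t / 2) (by linarith)
  calc 1 / Real.sin (t / 2) ≤ 1 / (2 / Real.pi * (t / 2)) :=
        one_div_le_one_div_of_le (by positivity) this
    _ = Real.pi / t := by field_simp

/-- The Hölder factor reduces the singularity `1/t` to the integrable `t^{α-1}`. The bound does not
depend on `p`, so it survives the passage to the principal value; the factor `1/α` in the final
constant originates here. -/
theorem norm_integral_mul_cot_le {α B p q : ℝ} {y : ℝ → ℂ} (hα : 0 < α) (hB : 0 ≤ B) (hp : 0 < p)
    (hpq : p ≤ q) (hq : q ≤ Real.pi) (hy : ∀ t ∈ Set.Icc p q, ‖y t‖ ≤ B * t ^ α) :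
    ‖∫ t in p..q, y t * (Real.cot (t / 2) : ℂ)‖ ≤ Real.pi * B * q ^ α / α := by
  have hpi := Real.pi_pos
  have h1 : ‖∫ t in p..q, y t * (Real.cot (t / 2) : ℂ)‖
      ≤ ∫ t in p..q, Real.pi * B * t ^ (α - 1) := by
    refine intervalIntegral.norm_integral_le_of_norm_le hpq (Eventually.of_forall fun t ht => ?_) ?_
    · have ht0 : 0 < t := hp.trans ht.1
      rw [norm_mul, Complex.norm_real, Real.norm_eq_abs]
      calc _ ≤ B * t ^ α * (Real.pi / t) :=
            mul_le_mul (hy t ⟨ht.1.le, ht.2⟩) (abs_cot_half_le ht0 (ht.2.trans hq)) (abs_nonneg _)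
              (by positivity)
        _ = _ := by rw [Real.rpow_sub_one ht0.ne']; ring
    · exact (intervalIntegral.intervalIntegrable_rpow' (by linarith)).const_mul _
  refine h1.trans ?_
  rw [intervalIntegral.integral_const_mul, integral_rpow (Or.inl (by linarith)), sub_add_cancel,
    ← mul_div_assoc]
  have : 0 ≤ p ^ α := by positivity
  gcongr
  linarith

theorem norm_integral_mul_cot_reflect_le {α B p q : ℝ} {y : ℝ → ℂ} (hα : 0 < α) (hB : 0 ≤ B)
    (hp : 0 < p) (hpq : p ≤ q) (hq : q ≤ Real.pi)
    (hy : ∀ t ∈ Set.Icc p q, ‖y (2 * Real.pi - t)‖ ≤ B * t ^ α) :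
    ‖∫ t in (2 * Real.pi - q)..(2 * Real.pi - p), y t * (Real.cot (t / 2) : ℂ)‖
      ≤ Real.pi * B * q ^ α / α := by
  rw [integral_mul_cot_reflect, norm_neg]
  exact norm_integral_mul_cot_le hα hB hp hpq hq hy

/-! ### The cells and their weights -/

/-- The left end of the `i`-th cell following `s_j^*`, relative to `s_j^*`. -/
noncomputable def cellEnd (n : ℕ) (h : ℝ) (i : ℕ) : ℝ := Real.pi * i / n - h

/-- The weight of the `i`-th cell following `s_j^*`. -/
noncomputable def cellIntegral (n : ℕ) (h : ℝ) (i : ℕ) : ℝ :=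
  ∫ t in cellEnd n h i..cellEnd n h (i + 1), Real.cot (t / 2)

theorem cellEnd_succ (n : ℕ) (h : ℝ) (i : ℕ) : cellEnd n h (i + 1) = cellEnd n h i + Real.pi / n := by
  simp only [cellEnd]; push_cast; ring

theorem cellEnd_le_succ (n : ℕ) (h : ℝ) (i : ℕ) : cellEnd n h i ≤ cellEnd n h (i + 1) := by
  rw [cellEnd_succ]; have := Real.pi_pos; linarith [show 0 ≤ Real.pi / n by positivity]

theorem cellEnd_two_mul {n : ℕ} (hn : 1 ≤ n) (h : ℝ) : cellEnd n h (2 * n) = 2 * Real.pi - h := by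
  have hn' : (n : ℝ) ≠ 0 := by positivity
  simp only [cellEnd]; push_cast; field_simp

theorem cellEnd_mono (n : ℕ) (h : ℝ) : Monotone (cellEnd n h) :=
  monotone_nat_of_le_succ (cellEnd_le_succ n h)

theorem cellEnd_one_pos {n : ℕ} {h : ℝ} (hh : h < Real.pi / n) : 0 < cellEnd n h 1 := by
  simp only [cellEnd, Nat.cast_one, mul_one]; linarith

theorem abs_cot_half_cell_le {n i : ℕ} {h t : ℝ} (h0 : 0 < h) (hh : h < Real.pi / n) (hi : 2 ≤ i)
    (hi' : i + 2 ≤ 2 * n) (ht : t ∈ Set.Icc (cellEnd n h i) (cellEnd n h (i + 1))) :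
    |Real.cot (t / 2)| ≤ n * (1 / ((i : ℝ) - 1) + 1 / (2 * n - 1 - i)) := by
  have hpi := Real.pi_pos
  have hn : (0 : ℝ) < n := by exact_mod_cast (by omega : 0 < n)
  have hi1 : (2 : ℝ) ≤ i := by exact_mod_cast hi
  have hi2 : (i : ℝ) + 2 ≤ 2 * n := by exact_mod_cast hi'
  have c1 : (0 : ℝ) < i - 1 := by linarith
  have c2 : (0 : ℝ) < 2 * n - 1 - i := by linarith
  obtain ⟨t0, t1⟩ := ht
  simp only [cellEnd] at t0 t1
  have a1 : Real.pi * (i - 1) / (2 * n) ≤ t / 2 := by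
    have : Real.pi * (i - 1) / (2 * n) = (Real.pi * i / n - Real.pi / n) / 2 := by field_simp
    linarith
  have a2 : Real.pi * (2 * n - 1 - i) / (2 * n) ≤ Real.pi - t / 2 := by
    have : Real.pi * (2 * n - 1 - i) / (2 * n)
        = Real.pi - (Real.pi * (i + 1 : ℕ) / n) / 2 := by push_cast; field_simp; ring
    linarith
  have b1 : 0 < Real.pi * (i - 1) / (2 * n) := by positivity
  have b2 : 0 < Real.pi * (2 * n - 1 - i) / (2 * n) := by positivity
  refine (abs_cot_le_inv_sin (by linarith) (by linarith)).trans
    ((inv_sin_le (by linarith) (by linarith)).trans ?_)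
  calc Real.pi / 2 * (1 / (t / 2) + 1 / (Real.pi - t / 2))
      ≤ Real.pi / 2 * (1 / (Real.pi * (i - 1) / (2 * n))
        + 1 / (Real.pi * (2 * n - 1 - i) / (2 * n))) := by gcongr
    _ = _ := by field_simp

theorem cellWeight_of_ne {n : ℕ} {h : ℝ} (h0 : 0 < h) (hh : h < Real.pi / n) {j k : Fin (2 * n)}
    (hjk : k ≠ j) :
    cellWeight n h j k = ∫ σ in knot n (k : ℕ)..knot n ((k : ℕ) + 1),
      Real.cot ((σ - shiftedKnot n h (j : ℕ)) / 2) := by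
  have hpi := Real.pi_pos
  have hn : (0 : ℝ) < n := by exact_mod_cast (by have := j.2; omega : 0 < n)
  have hle : knot n (k : ℕ) ≤ knot n ((k : ℕ) + 1) := by
    simp only [knot]; gcongr; simp
  refine Tendsto.limUnder_eq (tendsto_const_nhds.congr' ?_)
  -- The cells other than the `j`-th stay at least this far from `s_j^*`, so for smaller `ε` the
  -- excised ball misses them.
  have hpos : 0 < min h (Real.pi / n - h) := lt_min h0 (by linarith)
  filter_upwards [Ioo_mem_nhdsGT hpos] with ε hε
  have e1 := hε.2.trans_le (min_le_left _ _)
  have e2 := hε.2.trans_le (min_le_right _ _)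
  have hd : Set.Icc (knot n (k : ℕ)) (knot n ((k : ℕ) + 1)) \
      Metric.ball (shiftedKnot n h (j : ℕ)) ε
      = Set.Icc (knot n (k : ℕ)) (knot n ((k : ℕ) + 1)) := by
    rw [sdiff_eq_left, Set.disjoint_left]
    intro σ hσ hb
    rw [Metric.mem_ball, Real.dist_eq, abs_lt] at hb
    rcases lt_or_gt_of_ne (fun e => hjk (Fin.ext e) : (k : ℕ) ≠ j) with hlt | hlt
    · have h1 : knot n ((k : ℕ) + 1) ≤ knot n (j : ℕ) := by
        simp only [knot]; gcongr; exact_mod_cast hlt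
      have := hσ.2
      simp only [shiftedKnot] at hb
      linarith [hb.1]
    · have h1 : knot n (j : ℕ) + Real.pi / n ≤ knot n (k : ℕ) := by
        have : knot n (j : ℕ) + Real.pi / n = knot n ((j : ℕ) + 1) := by
          simp only [knot]; push_cast; ring
        rw [this]
        simp only [knot]; gcongr; exact_mod_cast hlt
      have := hσ.1
      simp only [shiftedKnot] at hb
      linarith [hb.2]
  rw [hd, intervalIntegral.integral_of_le hle, MeasureTheory.integral_Icc_eq_integral_Ioc]

theorem add_mod_of_lt {N i j : ℕ} (hj : j < N) (hi : i < N) :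
    (j + i) % N = if j + i < N then j + i else j + i - N := by
  split_ifs with h
  · exact Nat.mod_eq_of_lt h
  · rw [Nat.mod_eq_sub_mod (by omega), Nat.mod_eq_of_lt (by omega)]

theorem neighbor_offset_iff {n i : ℕ} (j : Fin (2 * n)) (hi : i < 2 * n)
    {k : Fin (2 * n)} (hk : (k : ℕ) = (j + i) % (2 * n)) :
    Neighbor j k ↔ i = 1 ∨ i + 1 = 2 * n := by
  have hj := j.2
  rw [add_mod_of_lt hj hi] at hk
  rw [Neighbor, add_mod_of_lt k.2 (by omega), add_mod_of_lt hj (by omega), hk]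
  split_ifs <;> omega

theorem offset_eq_iff {n i : ℕ} (j : Fin (2 * n)) (hi : i < 2 * n)
    {k : Fin (2 * n)} (hk : (k : ℕ) = (j + i) % (2 * n)) : k = j ↔ i = 0 := by
  have hj := j.2
  rw [add_mod_of_lt hj hi] at hk
  rw [Fin.ext_iff, hk]
  split_ifs <;> omega

theorem exists_knot_offset {n i : ℕ} (j : Fin (2 * n)) (hi : i < 2 * n)
    {k : Fin (2 * n)} (hk : (k : ℕ) = (j + i) % (2 * n)) :
    knot n (k : ℕ) = knot n (j : ℕ) + Real.pi * i / n ∨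
    knot n (k : ℕ) = knot n (j : ℕ) + Real.pi * i / n - 2 * Real.pi := by
  have hj := j.2
  have hn : (n : ℝ) ≠ 0 := by exact_mod_cast (by omega : n ≠ 0)
  rw [add_mod_of_lt hj hi] at hk
  split_ifs at hk with hlt
  · left; rw [hk]; simp only [knot]; push_cast; ring
  · right; rw [hk, Nat.cast_sub (by omega)]; simp only [knot]; push_cast; field_simp

theorem periodic_shiftedKnot_offset {β : Type*} {x : ℝ → β} (hx : Function.Periodic x (2 * Real.pi))
    {n i : ℕ} (h : ℝ) (j : Fin (2 * n)) (hi : i < 2 * n) {k : Fin (2 * n)}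
    (hk : (k : ℕ) = (j + i) % (2 * n)) :
    x (shiftedKnot n h (k : ℕ)) = x (shiftedKnot n h (j : ℕ) + Real.pi * i / n) := by
  simp only [shiftedKnot]
  rcases exists_knot_offset j hi hk with e | e
  · rw [e]; congr 1; ring
  · rw [e, ← hx.sub_eq (knot n (j : ℕ) + h + Real.pi * i / n)]; congr 1; ring

/-- Since `cot (t/2)` has period `2π`, a weight depends on `j` and `k` only through the cyclic
offset. -/
theorem cellWeight_offset {n i : ℕ} {h : ℝ} (h0 : 0 < h) (hh : h < Real.pi / n)
    (j : Fin (2 * n)) (hi0 : 1 ≤ i) (hi : i < 2 * n) {k : Fin (2 * n)}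
    (hk : (k : ℕ) = (j + i) % (2 * n)) : cellWeight n h j k = cellIntegral n h i := by
  rw [cellWeight_of_ne h0 hh (fun e => by have := (offset_eq_iff j hi hk).1 e; omega),
    integral_cot_translate, cellIntegral]
  have e1 : knot n ((k : ℕ) + 1) = knot n (k : ℕ) + Real.pi / n := by
    simp only [knot]; push_cast; ring
  rw [e1, cellEnd_succ]
  simp only [shiftedKnot, cellEnd]
  rcases exists_knot_offset j hi hk with e | e
  · rw [e]; congr 1 <;> ring
  · rw [e, ← integral_cot_sub_period (Real.pi * i / n - h)]; congr 1 <;> ring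

/-- The cancellation behind the principal value: the two terms `log sin (ε/2)` drop out, and the
value is independent of `ε`. -/
theorem integral_cot_half_symmetric {ε p q : ℝ} (h0 : 0 < ε) (hp : ε ≤ p) (hq : ε ≤ q)
    (hp' : p < 2 * Real.pi) (hq' : q < 2 * Real.pi) :
    (∫ t in ε..p, Real.cot (t / 2)) + ∫ t in (2 * Real.pi - q)..(2 * Real.pi - ε), Real.cot (t / 2)
      = 2 * Real.log (Real.sin (p / 2)) - 2 * Real.log (Real.sin (q / 2)) := by
  rw [integral_cot_half h0 hp' hp, integral_cot_half (by linarith) (by linarith) (by linarith)]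
  have : ∀ u : ℝ, Real.sin ((2 * Real.pi - u) / 2) = Real.sin (u / 2) := by
    intro u; rw [← Real.sin_pi_sub]; congr 1; ring
  rw [this, this]; ring

/-- The part of the cell left of `s_j^*` is moved by a period to the end near `2π`, after which the
symmetric cancellation applies. The term `-2 log sin (h/2)` is the source of diagonal dominance. -/
theorem cellWeight_self {n : ℕ} {h : ℝ} (h0 : 0 < h) (hh : h < Real.pi / n) (j : Fin (2 * n)) :
    cellWeight n h j j
      = 2 * Real.log (Real.sin ((Real.pi / n - h) / 2)) - 2 * Real.log (Real.sin (h / 2)) := by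
  have hpi := Real.pi_pos
  have hn1 : 1 ≤ n := by have := j.2; omega
  have hn : (1 : ℝ) ≤ n := by exact_mod_cast hn1
  have hpn : Real.pi / n ≤ Real.pi := div_le_self hpi.le hn
  refine Tendsto.limUnder_eq (tendsto_const_nhds.congr' ?_)
  have hpos : 0 < min h (Real.pi / n - h) := lt_min h0 (by linarith)
  filter_upwards [Ioo_mem_nhdsGT hpos] with ε hε
  have e0 : 0 < ε := hε.1
  have e1 := hε.2.trans_le (min_le_left _ _)
  have e2 := hε.2.trans_le (min_le_right _ _)
  set c := shiftedKnot n h (j : ℕ) with hc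
  have k0 : knot n (j : ℕ) = c - h := by simp only [hc, shiftedKnot]; ring
  have k1 : knot n ((j : ℕ) + 1) = c + (Real.pi / n - h) := by
    simp only [hc, shiftedKnot, knot]; push_cast; ring
  have hd : Set.Icc (knot n (j : ℕ)) (knot n ((j : ℕ) + 1)) \ Metric.ball c ε
      = Set.Icc (c - h) (c - ε) ∪ Set.Icc (c + ε) (c + (Real.pi / n - h)) := by
    rw [k0, k1, Real.ball_eq_Ioo]
    ext σ
    simp only [Set.mem_sdiff, Set.mem_Icc, Set.mem_Ioo, Set.mem_union, not_and_or, not_lt]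
    constructor
    · rintro ⟨⟨a, b⟩, d | d⟩
      · exact Or.inl ⟨a, d⟩
      · exact Or.inr ⟨d, b⟩
    · rintro (⟨a, b⟩ | ⟨a, b⟩)
      · exact ⟨⟨a, by linarith⟩, Or.inl b⟩
      · exact ⟨⟨by linarith, b⟩, Or.inr a⟩
  have hcont : ∀ a b : ℝ, (∀ σ ∈ Set.Icc a b, Real.sin ((σ - c) / 2) ≠ 0) →
      MeasureTheory.IntegrableOn (fun σ => Real.cot ((σ - c) / 2)) (Set.Icc a b) := by
    intro a b hs
    apply ContinuousOn.integrableOn_Icc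
    simp only [Real.cot_eq_cos_div_sin]
    exact ContinuousOn.div (by fun_prop) (by fun_prop) hs
  rw [hd, MeasureTheory.setIntegral_union ?_ measurableSet_Icc ?_ ?_,
    MeasureTheory.integral_Icc_eq_integral_Ioc, MeasureTheory.integral_Icc_eq_integral_Ioc,
    ← intervalIntegral.integral_of_le (by linarith), ← intervalIntegral.integral_of_le (by linarith),
    integral_cot_translate, integral_cot_translate,
    ← integral_cot_half_symmetric e0 e2.le e1.le (by linarith) (by linarith), add_comm,
    ← integral_cot_sub_period (2 * Real.pi - h)]
  · congr 2 <;> ring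
  · rw [Set.disjoint_left]
    intro σ h1 h2
    linarith [h1.2, h2.1]
  · refine hcont _ _ fun σ hσ => ?_
    have := Real.sin_neg_of_neg_of_neg_pi_lt (x := (σ - c) / 2) (by linarith [hσ.2])
      (by linarith [hσ.1])
    exact this.ne
  · refine hcont _ _ fun σ hσ => ?_
    have := Real.sin_pos_of_pos_of_lt_pi (x := (σ - c) / 2) (by linarith [hσ.1])
      (by linarith [hσ.2])
    exact this.ne'

theorem abs_cellIntegral_le {n i : ℕ} {h : ℝ} (h0 : 0 < h) (hh : h < Real.pi / n) (hi : 2 ≤ i)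
    (hi' : i + 2 ≤ 2 * n) : |cellIntegral n h i| ≤ 2 * Real.pi := by
  have hpi := Real.pi_pos
  have hn : (0 : ℝ) < n := by exact_mod_cast (by omega : 0 < n)
  have hi1 : (2 : ℝ) ≤ i := by exact_mod_cast hi
  have hi2 : (i : ℝ) + 2 ≤ 2 * n := by exact_mod_cast hi'
  have h1 := intervalIntegral.norm_integral_le_of_norm_le_const (a := cellEnd n h i)
    (b := cellEnd n h (i + 1)) (f := fun t => Real.cot (t / 2)) (C := n * 2) fun t ht => by
      rw [Set.uIoc_of_le (cellEnd_le_succ n h i)] at ht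
      refine (abs_cot_half_cell_le h0 hh hi hi' ⟨ht.1.le, ht.2⟩).trans ?_
      have e1 : 1 / ((i : ℝ) - 1) ≤ 1 := by rw [div_le_one] <;> linarith
      have e2 : 1 / (2 * (n : ℝ) - 1 - i) ≤ 1 := by rw [div_le_one] <;> linarith
      gcongr
      linarith
  have hl : cellEnd n h (i + 1) - cellEnd n h i = Real.pi / n := by rw [cellEnd_succ]; ring
  rw [hl, abs_of_pos (by positivity)] at h1
  refine h1.trans (le_of_eq ?_)
  field_simp

theorem sum_fin_eq_sum_range_offset {β : Type*} [AddCommGroup β] {N : ℕ} (Φ : Fin N → β)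
    (j : Fin N) :
    ∑ k, Φ k = ∑ i ∈ Finset.range N, Φ ⟨(j + i) % N, Nat.mod_lt _ j.pos⟩ := by
  have hN := j.pos
  have key : ∀ a : ℕ, Φ ⟨((a : ℤ) % N).toNat, by
      have := Int.emod_lt_of_pos (a : ℤ) (by exact_mod_cast hN : (0 : ℤ) < N); omega⟩
      = Φ ⟨a % N, Nat.mod_lt _ hN⟩ := by
    intro a; congr 1
  have h1 := sum_fin_eq_sum_range_shift (N := N) (F := fun k : ℤ => Φ ⟨(k % N).toNat, by
      have := Int.emod_lt_of_pos k (by exact_mod_cast hN : (0 : ℤ) < N); omega⟩)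
      (fun k => by simp) ((j : ℕ) : ℤ)
  simp only [← Nat.cast_add, key] at h1
  rw [← h1]
  exact Finset.sum_congr rfl fun k _ => by congr 1; exact Fin.ext (Nat.mod_eq_of_lt k.2).symm

/-! ### The quadrature formula for the singular integral -/

theorem IsHolder.translate {α M : ℝ} {x : ℝ → ℂ} (hx : IsHolder α M x) (c : ℝ) :
    IsHolder α M fun t => x (c + t) :=
  ⟨fun t => by simp only [← add_assoc]; exact hx.1 _, fun s t => by
    simpa using hx.2 (c + s) (c + t)⟩

theorem two_pi_div_rpow_le {α : ℝ} (hα1 : α ≤ 1) (n : ℕ) :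
    (2 * Real.pi / n) ^ α ≤ 2 * Real.pi / (n : ℝ) ^ α := by
  have hpi := Real.pi_gt_three
  rw [Real.div_rpow (by positivity) (Nat.cast_nonneg n)]
  gcongr
  simpa using Real.rpow_le_rpow_of_exponent_le (by linarith : (1 : ℝ) ≤ 2 * Real.pi) hα1

/-- Going once round from the singular point: the right part of the central cell, the `2n - 1` whole
cells, and the left part of the central cell, which appears just before `2π`. -/
theorem integral_eq_sum_cells {y : ℝ → ℂ} (hy : Continuous y) {n : ℕ} (hn : 1 ≤ n) {h ε : ℝ}
    (h0 : 0 < h) (hε : 0 < ε) (hεh : ε ≤ h) (hε1 : ε ≤ cellEnd n h 1) :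
    ∫ t in ε..(2 * Real.pi - ε), y t * (Real.cot (t / 2) : ℂ)
      = (∫ t in ε..cellEnd n h 1, y t * (Real.cot (t / 2) : ℂ))
        + (∑ i ∈ Finset.range (2 * n - 1),
          ∫ t in cellEnd n h (i + 1)..cellEnd n h (i + 1 + 1), y t * (Real.cot (t / 2) : ℂ))
        + ∫ t in (2 * Real.pi - h)..(2 * Real.pi - ε), y t * (Real.cot (t / 2) : ℂ) := by
  have hlast : cellEnd n h (2 * n - 1 + 1) = 2 * Real.pi - h := by
    rw [Nat.sub_add_cancel (by omega), cellEnd_two_mul hn]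
  have hle : cellEnd n h 1 ≤ cellEnd n h (2 * n - 1 + 1) := cellEnd_mono n h (by omega)
  have hcell : ∀ i < 2 * n - 1, IntervalIntegrable (fun t => y t * (Real.cot (t / 2) : ℂ))
      MeasureTheory.volume (cellEnd n h (i + 1)) (cellEnd n h (i + 1 + 1)) := by
    intro i hi
    refine intervalIntegrable_mul_cot_half hy ?_ ?_ (cellEnd_le_succ n h _)
    · exact (hε.trans_le hε1).trans_le (cellEnd_mono n h (by omega))
    · have := cellEnd_mono n h (by omega : i + 1 + 1 ≤ 2 * n - 1 + 1)
      linarith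
  rw [intervalIntegral.sum_integral_adjacent_intervals (a := fun i => cellEnd n h (i + 1)) hcell]
  simp only [zero_add]
  rw [intervalIntegral.integral_add_adjacent_intervals
      (intervalIntegrable_mul_cot_half hy hε (by linarith) hε1)
      (intervalIntegrable_mul_cot_half hy (by linarith) (by linarith) hle),
    ← hlast, intervalIntegral.integral_add_adjacent_intervals
      (intervalIntegrable_mul_cot_half hy hε (by linarith) (by linarith))
      (intervalIntegrable_mul_cot_half hy (by linarith) (by linarith) (by linarith))]

/-- The central weight equals the truncated integral of the cotangent for every small `ε`, so only
the integral of `y - y 0` remains, and its bound is uniform in `ε`. -/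
theorem norm_central_cell_error_le {α M : ℝ} {y : ℝ → ℂ} (hα : 0 < α) (hα1 : α ≤ 1)
    (hy : IsHolder α M y) {n : ℕ} (hn : 1 ≤ n) {h ε : ℝ} (h0 : 0 < h)
    (hε : 0 < ε) (hεh : ε ≤ h) (hε1 : ε ≤ Real.pi / n - h) :
    ‖((2 * Real.log (Real.sin ((Real.pi / n - h) / 2)) - 2 * Real.log (Real.sin (h / 2)) : ℝ) : ℂ)
        * y 0 - (∫ t in ε..(Real.pi / n - h), y t * (Real.cot (t / 2) : ℂ))
        - ∫ t in (2 * Real.pi - h)..(2 * Real.pi - ε), y t * (Real.cot (t / 2) : ℂ)‖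
      ≤ 2 * (Real.pi * M * (Real.pi / (n : ℝ) ^ α) / α) := by
  have hpi := Real.pi_pos
  have hM := hy.const_nonneg
  have hpn : Real.pi / n ≤ Real.pi := div_le_self hpi.le (by exact_mod_cast hn)
  have hyc := hy.continuous hα
  have hsub : ∀ p q : ℝ, 0 < p → q < 2 * Real.pi → p ≤ q →
      ∫ t in p..q, (y t - y 0) * (Real.cot (t / 2) : ℂ)
        = (∫ t in p..q, y t * (Real.cot (t / 2) : ℂ))
          - y 0 * ((∫ t in p..q, Real.cot (t / 2) : ℝ) : ℂ) := by
    intro p q hp hq hpq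
    rw [← intervalIntegral.integral_ofReal, ← intervalIntegral.integral_const_mul,
      ← intervalIntegral.integral_sub (intervalIntegrable_mul_cot_half hyc hp hq hpq)
        (intervalIntegrable_mul_cot_half continuous_const hp hq hpq)]
    simp only [sub_mul]
  rw [← integral_cot_half_symmetric hε hε1 hεh (by linarith) (by linarith)]
  have e1 := hsub ε (Real.pi / n - h) hε (by linarith) hε1
  have e2 := hsub (2 * Real.pi - h) (2 * Real.pi - ε) (by linarith) (by linarith) (by linarith)
  have b1 : ‖∫ t in ε..(Real.pi / n - h), (y t - y 0) * (Real.cot (t / 2) : ℂ)‖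
      ≤ Real.pi * M * (Real.pi / (n : ℝ) ^ α) / α := by
    refine (norm_integral_mul_cot_le hα hM hε hε1 (by linarith) fun t ht => ?_).trans ?_
    · have := hy.2 t 0
      rwa [sub_zero, abs_of_pos (hε.trans_le ht.1)] at this
    · gcongr
      exact (Real.rpow_le_rpow (by linarith) (by linarith) hα.le).trans (pi_div_rpow_le hα1 n)
  have b2 : ‖∫ t in (2 * Real.pi - h)..(2 * Real.pi - ε), (y t - y 0) * (Real.cot (t / 2) : ℂ)‖
      ≤ Real.pi * M * (Real.pi / (n : ℝ) ^ α) / α := by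
    refine (norm_integral_mul_cot_reflect_le hα hM hε hεh (by linarith) fun t ht => ?_).trans ?_
    · have := hy.2 (-t) 0
      rw [sub_zero, abs_neg, abs_of_pos (hε.trans_le ht.1)] at this
      rwa [← hy.1 (-t), neg_add_eq_sub] at this
    · gcongr
      exact (Real.rpow_le_rpow (by linarith) (by linarith) hα.le).trans (pi_div_rpow_le hα1 n)
  have alg : ∀ (A B : ℝ) (I J : ℂ), ((A + B : ℝ) : ℂ) * y 0 - I - J
      = -((I - y 0 * A) + (J - y 0 * B)) := by
    intro A B I J; push_cast; ring
  rw [alg, ← e1, ← e2, norm_neg]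
  exact ((norm_add_le _ _).trans (add_le_add b1 b2)).trans (le_of_eq (two_mul _).symm)

/-- The slope bound `n^{1-α}` is exactly what makes the line's increment Hölder of order `α` at
distances of order `1/n`: `|κ| t ≤ (nt)^{1-α} t^α`. -/
theorem norm_slope_mul_le {α : ℝ} (hα : 0 < α) (hα1 : α ≤ 1) {n : ℕ} (hn : 1 ≤ n) {κ : ℂ}
    (hκ : ‖κ‖ ≤ (n : ℝ) ^ (1 - α)) {t : ℝ} (ht : 0 < t) (ht' : t ≤ 2 * Real.pi / n) :
    ‖κ‖ * t ≤ 2 * Real.pi * t ^ α := by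
  have hpi := Real.pi_gt_three
  have hn0 : (0 : ℝ) < n := by exact_mod_cast hn
  have h1 : t = t ^ (1 - α) * t ^ α := by rw [← Real.rpow_add ht]; simp
  have h2 : ((n : ℝ) ^ (1 - α)) * t ^ (1 - α) ≤ 2 * Real.pi := by
    rw [← Real.mul_rpow hn0.le ht.le]
    have h3 : n * t ≤ 2 * Real.pi := by rwa [le_div_iff₀ hn0, mul_comm] at ht'
    calc (n * t) ^ (1 - α) ≤ (2 * Real.pi) ^ (1 - α) :=
          Real.rpow_le_rpow (by positivity) h3 (by linarith)
      _ ≤ (2 * Real.pi) ^ (1 : ℝ) :=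
          Real.rpow_le_rpow_of_exponent_le (by linarith) (by linarith)
      _ = 2 * Real.pi := Real.rpow_one _
  calc ‖κ‖ * t ≤ (n : ℝ) ^ (1 - α) * t := by gcongr
    _ = (n : ℝ) ^ (1 - α) * t ^ (1 - α) * t ^ α := by rw [mul_assoc, ← h1]
    _ ≤ _ := by gcongr

/-- The condition defining the auxiliary slope, in coordinates centred at `s_j^*`. -/
theorem IsAuxSlope.cells {n : ℕ} (hn : 1 ≤ n) {h : ℝ} {x : ℝ → ℂ} {j : ℤ} {κ : ℂ}
    (hκ : IsAuxSlope n h x j κ) :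
    (∫ t in cellEnd n h (2 * n - 1)..cellEnd n h (2 * n),
        (x (shiftedKnot n h j) + κ * ((t - 2 * Real.pi : ℝ) : ℂ)) * (Real.cot (t / 2) : ℂ))
      + (∫ t in cellEnd n h 1..cellEnd n h 2,
        (x (shiftedKnot n h j) + κ * (t : ℂ)) * (Real.cot (t / 2) : ℂ)) = 0 := by
  have hn' : (n : ℝ) ≠ 0 := by positivity
  unfold IsAuxSlope at hκ
  rw [integral_mul_cot_translate (fun σ => x (shiftedKnot n h j)
      + κ * ((σ - shiftedKnot n h j : ℝ) : ℂ)),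
    integral_mul_cot_translate (fun σ => x (shiftedKnot n h j)
      + κ * ((σ - shiftedKnot n h j : ℝ) : ℂ))] at hκ
  simp only [add_sub_cancel_left] at hκ
  have e1 : knot n (j - 1) - shiftedKnot n h j = cellEnd n h (2 * n - 1) - 2 * Real.pi := by
    simp only [knot, shiftedKnot, cellEnd]
    rw [Nat.cast_sub (by omega)]; push_cast; field_simp; ring
  have e2 : knot n j - shiftedKnot n h j = cellEnd n h (2 * n) - 2 * Real.pi := by
    rw [cellEnd_two_mul hn]; simp only [shiftedKnot]; ring
  have e3 : knot n (j + 1) - shiftedKnot n h j = cellEnd n h 1 := by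
    simp only [knot, shiftedKnot, cellEnd]; push_cast; ring
  have e4 : knot n (j + 2) - shiftedKnot n h j = cellEnd n h 2 := by
    simp only [knot, shiftedKnot, cellEnd]; push_cast; ring
  rw [e1, e2, e3, e4, integral_mul_cot_sub_period (fun t => x (shiftedKnot n h j) + κ * (t : ℂ))] at hκ
  exact hκ

/-- These cells are absent from the system, so their whole integral is error. Subtracting the
auxiliary line costs nothing by `hκ`, and the difference vanishes like `t^α` at the singular point.
For `n ≥ 2` both cells lie within distance `π` of that point. -/
theorem norm_neighbor_cells_le {α M : ℝ} {y : ℝ → ℂ} (hα : 0 < α) (hα1 : α ≤ 1)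
    (hy : IsHolder α M y) {n : ℕ} (hn : 2 ≤ n) {h : ℝ} (h0 : 0 < h) (hh : h < Real.pi / n)
    {κ : ℂ} (hκ' : ‖κ‖ ≤ (n : ℝ) ^ (1 - α))
    (hκ : (∫ t in cellEnd n h (2 * n - 1)..cellEnd n h (2 * n),
        (y 0 + κ * ((t - 2 * Real.pi : ℝ) : ℂ)) * (Real.cot (t / 2) : ℂ))
      + (∫ t in cellEnd n h 1..cellEnd n h 2, (y 0 + κ * (t : ℂ)) * (Real.cot (t / 2) : ℂ)) = 0) :
    ‖(∫ t in cellEnd n h (2 * n - 1)..cellEnd n h (2 * n), y t * (Real.cot (t / 2) : ℂ))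
      + ∫ t in cellEnd n h 1..cellEnd n h 2, y t * (Real.cot (t / 2) : ℂ)‖
      ≤ 2 * (Real.pi * (M + 2 * Real.pi) * (2 * Real.pi / (n : ℝ) ^ α) / α) := by
  have hpi := Real.pi_pos
  have hM := hy.const_nonneg
  have hyc := hy.continuous hα
  have hn2 : (2 : ℝ) ≤ n := by exact_mod_cast hn
  have hpn : 2 * Real.pi / n ≤ Real.pi := by rw [div_le_iff₀ (by linarith)]; nlinarith
  have hpn2 : 2 * Real.pi / n = Real.pi / n + Real.pi / n := by ring
  have a1 : 0 < cellEnd n h 1 := cellEnd_one_pos hh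
  have a2 : cellEnd n h 2 = 2 * Real.pi / n - h := by simp only [cellEnd]; push_cast; ring
  have a3 : cellEnd n h (2 * n) = 2 * Real.pi - h := cellEnd_two_mul (by omega) h
  have a4 : cellEnd n h (2 * n - 1) = 2 * Real.pi - (Real.pi / n + h) := by
    have := cellEnd_succ n h (2 * n - 1)
    rw [Nat.sub_add_cancel (by omega), a3] at this
    linarith
  have hsub : ∀ (z : ℝ → ℂ), Continuous z → ∀ p q : ℝ, 0 < p → q < 2 * Real.pi → p ≤ q →
      ∫ t in p..q, y t * (Real.cot (t / 2) : ℂ) = (∫ t in p..q, z t * (Real.cot (t / 2) : ℂ))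
        + ∫ t in p..q, (y t - z t) * (Real.cot (t / 2) : ℂ) := by
    intro z hz p q hp hq hpq
    rw [← intervalIntegral.integral_add (intervalIntegrable_mul_cot_half hz hp hq hpq)
        (intervalIntegrable_mul_cot_half (y := fun t => y t - z t) (hyc.sub hz) hp hq hpq)]
    congr 1; funext t; ring
  have pow_le : ∀ q : ℝ, 0 ≤ q → q ≤ 2 * Real.pi / n →
      Real.pi * (M + 2 * Real.pi) * q ^ α / α
        ≤ Real.pi * (M + 2 * Real.pi) * (2 * Real.pi / (n : ℝ) ^ α) / α := by
    intro q hq0 hq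
    gcongr
    exact (Real.rpow_le_rpow hq0 hq hα.le).trans (two_pi_div_rpow_le hα1 n)
  have b1 : ‖∫ t in cellEnd n h 1..cellEnd n h 2,
      (y t - (y 0 + κ * (t : ℂ))) * (Real.cot (t / 2) : ℂ)‖
      ≤ Real.pi * (M + 2 * Real.pi) * (2 * Real.pi / (n : ℝ) ^ α) / α := by
    refine (norm_integral_mul_cot_le hα (by positivity) a1 (cellEnd_le_succ n h 1) (by linarith)
      fun t ht => ?_).trans (pow_le _ (a1.le.trans (cellEnd_le_succ n h 1)) (by linarith))
    have ht0 : 0 < t := a1.trans_le ht.1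
    have h1 := hy.2 t 0
    rw [sub_zero, abs_of_pos ht0] at h1
    have h2 := norm_slope_mul_le hα hα1 (by omega : 1 ≤ n) hκ' ht0 (by linarith [ht.2])
    rw [← sub_sub]
    refine (norm_sub_le _ _).trans ?_
    rw [norm_mul, Complex.norm_real, Real.norm_eq_abs, abs_of_pos ht0]
    linarith
  have b2 : ‖∫ t in cellEnd n h (2 * n - 1)..cellEnd n h (2 * n),
      (y t - (y 0 + κ * ((t - 2 * Real.pi : ℝ) : ℂ))) * (Real.cot (t / 2) : ℂ)‖
      ≤ Real.pi * (M + 2 * Real.pi) * (2 * Real.pi / (n : ℝ) ^ α) / α := by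
    rw [a3, a4]
    refine (norm_integral_mul_cot_reflect_le hα (by positivity) h0 (by linarith) (by linarith)
      fun t ht => ?_).trans (pow_le _ (by positivity) (by linarith))
    have ht0 : 0 < t := h0.trans_le ht.1
    have h1 := hy.2 (-t) 0
    rw [sub_zero, abs_neg, abs_of_pos ht0, ← hy.1 (-t), neg_add_eq_sub] at h1
    have h2 := norm_slope_mul_le hα hα1 (by omega : 1 ≤ n) hκ' ht0 (by linarith [ht.2])
    have e : 2 * Real.pi - t - 2 * Real.pi = -t := by ring
    rw [← sub_sub, e]
    refine (norm_sub_le _ _).trans ?_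
    rw [norm_mul, Complex.norm_real, Real.norm_eq_abs, abs_neg, abs_of_pos ht0]
    linarith
  rw [hsub (fun t => y 0 + κ * ((t - 2 * Real.pi : ℝ) : ℂ)) (by fun_prop) _ _
      (by rw [a4]; linarith) (by rw [a3]; linarith) (by rw [a3, a4]; linarith),
    hsub (fun t => y 0 + κ * (t : ℂ)) (by fun_prop) _ _ a1 (by linarith)
      (cellEnd_le_succ n h 1), add_add_add_comm, hκ, zero_add]
  exact ((norm_add_le _ _).trans (add_le_add b2 b1)).trans (le_of_eq (two_mul _).symm)

/-- The oscillation of `y` over a cell, of order `n^{-α}`, is multiplied by the cell length `π/n`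
and by a bound for the cotangent that is `n` times a harmonic term. -/
theorem norm_far_cell_error_le {α M : ℝ} {y : ℝ → ℂ} (hα : 0 < α) (hα1 : α ≤ 1)
    (hy : IsHolder α M y) {n i : ℕ} {h : ℝ} (h0 : 0 < h) (hh : h < Real.pi / n)
    (hi : 2 ≤ i) (hi' : i + 2 ≤ 2 * n) :
    ‖(cellIntegral n h i : ℂ) * y (Real.pi * i / n)
      - ∫ t in cellEnd n h i..cellEnd n h (i + 1), y t * (Real.cot (t / 2) : ℂ)‖
      ≤ Real.pi ^ 2 * M / (n : ℝ) ^ α * (1 / ((i : ℝ) - 1) + 1 / (2 * n - 1 - i)) := by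
  have hpi := Real.pi_pos
  have hM := hy.const_nonneg
  have hn : (0 : ℝ) < n := by exact_mod_cast (by omega : 0 < n)
  have hi1 : (2 : ℝ) ≤ i := by exact_mod_cast hi
  have hi2 : (i : ℝ) + 2 ≤ 2 * n := by exact_mod_cast hi'
  have hp : 0 < cellEnd n h i := (cellEnd_one_pos hh).trans_le (cellEnd_mono n h (by omega))
  have hq : cellEnd n h (i + 1) < 2 * Real.pi := by
    have := cellEnd_mono n h (by omega : i + 1 ≤ 2 * n)
    rw [cellEnd_two_mul (by omega)] at this
    linarith
  have hpq := cellEnd_le_succ n h i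
  have e : (cellIntegral n h i : ℂ) * y (Real.pi * i / n)
      - ∫ t in cellEnd n h i..cellEnd n h (i + 1), y t * (Real.cot (t / 2) : ℂ)
      = ∫ t in cellEnd n h i..cellEnd n h (i + 1),
        (y (Real.pi * i / n) - y t) * (Real.cot (t / 2) : ℂ) := by
    rw [cellIntegral, ← intervalIntegral.integral_ofReal, mul_comm,
      ← intervalIntegral.integral_const_mul, ← intervalIntegral.integral_sub
        (intervalIntegrable_mul_cot_half continuous_const hp hq hpq)
        (intervalIntegrable_mul_cot_half (hy.continuous hα) hp hq hpq)]
    simp only [sub_mul]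
  have hβ : 0 ≤ 1 / ((i : ℝ) - 1) + 1 / (2 * n - 1 - i) :=
    add_nonneg (one_div_nonneg.2 (by linarith)) (one_div_nonneg.2 (by linarith))
  rw [e]
  have h1 := intervalIntegral.norm_integral_le_of_norm_le_const (a := cellEnd n h i)
    (b := cellEnd n h (i + 1))
    (f := fun t => (y (Real.pi * i / n) - y t) * (Real.cot (t / 2) : ℂ))
    (C := M * (Real.pi / (n : ℝ) ^ α) * (n * (1 / ((i : ℝ) - 1) + 1 / (2 * n - 1 - i))))
    fun t ht => by
      rw [Set.uIoc_of_le hpq] at ht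
      rw [norm_mul, Complex.norm_real, Real.norm_eq_abs]
      refine mul_le_mul ?_ (abs_cot_half_cell_le h0 hh hi hi' ⟨ht.1.le, ht.2⟩) (abs_nonneg _)
        (by positivity)
      refine (hy.2 _ _).trans ?_
      gcongr
      refine (Real.rpow_le_rpow (abs_nonneg _) ?_ hα.le).trans (pi_div_rpow_le hα1 n)
      have t1 := ht.1
      have t2 := ht.2
      rw [cellEnd_succ] at t2
      simp only [cellEnd] at t1 t2
      rw [abs_le]; constructor <;> linarith
  have hl : cellEnd n h (i + 1) - cellEnd n h i = Real.pi / n := by rw [cellEnd_succ]; ring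
  rw [hl, abs_of_pos (by positivity)] at h1
  refine h1.trans (le_of_eq ?_)
  field_simp

open Classical in
-- In cyclic offsets from `j`, the system keeps `0` and `2, …, 2n - 2`, the latter being `m = 2n -
-- 3` offsets; the neighbours are `1` and `2n - 1`.
theorem sum_weights_eq {x : ℝ → ℂ} (hx : Function.Periodic x (2 * Real.pi)) {n m : ℕ}
    (hm : 2 * n = m + 3) {h : ℝ} (h0 : 0 < h) (hh : h < Real.pi / n) (j : Fin (2 * n)) :
    ∑ k, (if Neighbor j k then 0 else (cellWeight n h j k : ℂ)) * x (shiftedKnot n h (k : ℕ))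
      = (cellWeight n h j j : ℂ) * x (shiftedKnot n h (j : ℕ) + 0)
        + ∑ r ∈ Finset.range m, (cellIntegral n h (r + 2) : ℂ)
          * x (shiftedKnot n h (j : ℕ) + Real.pi * (r + 2 : ℕ) / n) := by
  rw [sum_fin_eq_sum_range_offset _ j]
  have term : ∀ i ∈ Finset.range (2 * n),
      (if Neighbor j ⟨((j : ℕ) + i) % (2 * n), Nat.mod_lt _ j.pos⟩ then 0 else
        (cellWeight n h j ⟨((j : ℕ) + i) % (2 * n), Nat.mod_lt _ j.pos⟩ : ℂ))
        * x (shiftedKnot n h ((⟨((j : ℕ) + i) % (2 * n), Nat.mod_lt _ j.pos⟩ : Fin (2 * n)) : ℕ))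
      = if i = 1 ∨ i + 1 = 2 * n then 0 else
        (if i = 0 then (cellWeight n h j j : ℂ) else (cellIntegral n h i : ℂ))
          * x (shiftedKnot n h (j : ℕ) + Real.pi * i / n) := by
    intro i hi
    have hi := Finset.mem_range.1 hi
    rw [periodic_shiftedKnot_offset hx h j hi rfl, if_congr (neighbor_offset_iff j hi rfl) rfl rfl]
    split_ifs with h1 h2
    · rw [zero_mul]
    · have e : (⟨((j : ℕ) + i) % (2 * n), Nat.mod_lt _ j.pos⟩ : Fin (2 * n)) = j :=
        (offset_eq_iff j hi rfl).2 h2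
      rw [e]
    · rw [cellWeight_offset h0 hh j (by omega) hi rfl]
  have hrange : Finset.range (2 * n) = Finset.range (m + 3) := by rw [hm]
  rw [Finset.sum_congr rfl term, hrange, Finset.sum_range_succ, Finset.sum_range_succ',
    Finset.sum_range_succ', if_pos (by omega : m + 2 = 1 ∨ m + 2 + 1 = 2 * n),
    if_pos (by omega : 0 + 1 = 1 ∨ 0 + 1 + 1 = 2 * n),
    if_neg (by omega : ¬(0 = 1 ∨ 0 + 1 = 2 * n)), if_pos rfl]
  have far : ∀ r ∈ Finset.range m, (if r + 1 + 1 = 1 ∨ r + 1 + 1 + 1 = 2 * n then (0 : ℂ) else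
      (if r + 1 + 1 = 0 then (cellWeight n h j j : ℂ) else (cellIntegral n h (r + 1 + 1) : ℂ))
        * x (shiftedKnot n h (j : ℕ) + Real.pi * (r + 1 + 1 : ℕ) / n))
      = (cellIntegral n h (r + 2) : ℂ)
        * x (shiftedKnot n h (j : ℕ) + Real.pi * (r + 2 : ℕ) / n) := by
    intro r hr
    have := Finset.mem_range.1 hr
    rw [if_neg (by omega), if_neg (by omega)]
  rw [Finset.sum_congr rfl far]
  simp only [Nat.cast_zero, mul_zero, zero_div, add_zero]
  ring

/-- The constant in the error bound of the quadrature formula. -/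
noncomputable def quadratureConst (α M : ℝ) : ℝ :=
  (4 * (Real.pi * M * Real.pi) + 4 * (Real.pi * (M + 2 * Real.pi) * (2 * Real.pi))) / α
    + 8 * (Real.pi ^ 2 * M)

open Classical in
theorem norm_quadrature_error_le {α M : ℝ} {x : ℝ → ℂ} (hα : 0 < α) (hα1 : α ≤ 1)
    (hx : IsHolder α M x) {n : ℕ} (hn : 2 ≤ n) {h : ℝ} (h0 : 0 < h) (hh : h < Real.pi / n)
    (j : Fin (2 * n)) {κ p : ℂ} (hκ : IsAuxSlope n h x (j : ℕ) κ) (hκ' : ‖κ‖ ≤ (n : ℝ) ^ (1 - α))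
    (hp : HasHilbertPV x (shiftedKnot n h (j : ℕ)) p) :
    ‖∑ k, (if Neighbor j k then 0 else (cellWeight n h j k : ℂ)) * x (shiftedKnot n h (k : ℕ)) - p‖
      ≤ quadratureConst α M * Real.log n / (n : ℝ) ^ α := by
  have hpi := Real.pi_pos
  have hM := hx.const_nonneg
  have hn0 : (0 : ℝ) < n := by exact_mod_cast (by omega : 0 < n)
  obtain ⟨m, hm⟩ : ∃ m, 2 * n = m + 3 := ⟨2 * n - 3, by omega⟩
  have hmc : (2 * n : ℝ) = m + 3 := by exact_mod_cast hm
  set c := shiftedKnot n h (j : ℕ) with hc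
  set y : ℝ → ℂ := fun t => x (c + t) with hydef
  have hy : IsHolder α M y := hx.translate c
  have hy0 : y 0 = x c := by simp [hydef]
  have hcells := hκ.cells (by omega)
  rw [← hc, ← hy0] at hcells
  -- The estimate is proved for every small truncation `ε` with a bound free of `ε`, and then passes
  -- to the limit.
  refine le_of_tendsto (tendsto_const_nhds.sub hp).norm ?_
  have hpos : 0 < min h (Real.pi / n - h) := lt_min h0 (by linarith)
  filter_upwards [Ioo_mem_nhdsGT hpos] with ε hε
  have e0 : 0 < ε := hε.1
  have e1 := hε.2.trans_le (min_le_left _ _)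
  have e2 := hε.2.trans_le (min_le_right _ _)
  have hend1 : cellEnd n h 1 = Real.pi / n - h := by simp [cellEnd]
  rw [sum_weights_eq hx.1 hm h0 hh, integral_mul_cot_translate]
  have i1 : c + ε - c = ε := by ring
  have i2 : c + 2 * Real.pi - ε - c = 2 * Real.pi - ε := by ring
  rw [i1, i2]
  change ‖(cellWeight n h j j : ℂ) * y 0 + ∑ r ∈ Finset.range m, (cellIntegral n h (r + 2) : ℂ)
    * y (Real.pi * (r + 2 : ℕ) / n)
    - ∫ t in ε..(2 * Real.pi - ε), y t * (Real.cot (t / 2) : ℂ)‖ ≤ _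
  rw [integral_eq_sum_cells (hy.continuous hα) (by omega : 1 ≤ n) h0 e0 e1.le (by rw [hend1]; exact e2.le),
    (by omega : 2 * n - 1 = m + 1 + 1), Finset.sum_range_succ, Finset.sum_range_succ',
    cellWeight_self h0 hh, hend1]
  have hA := norm_central_cell_error_le hα hα1 hy (by omega : 1 ≤ n) h0 e0 e1.le e2.le
  have hB := norm_neighbor_cells_le hα hα1 hy hn h0 hh hκ' hcells
  rw [(by omega : 2 * n - 1 = m + 1 + 1), (by omega : 2 * n = m + 1 + 1 + 1), hend1] at hB
  have hC : ‖∑ r ∈ Finset.range m, ((cellIntegral n h (r + 2) : ℂ) * y (Real.pi * (r + 2 : ℕ) / n)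
      - ∫ t in cellEnd n h (r + 1 + 1)..cellEnd n h (r + 1 + 1 + 1),
        y t * (Real.cot (t / 2) : ℂ))‖ ≤ Real.pi ^ 2 * M / (n : ℝ) ^ α * (8 * Real.log n) := by
    have hterm : ∀ r ∈ Finset.range m,
        ‖(cellIntegral n h (r + 2) : ℂ) * y (Real.pi * (r + 2 : ℕ) / n)
        - ∫ t in cellEnd n h (r + 1 + 1)..cellEnd n h (r + 1 + 1 + 1),
          y t * (Real.cot (t / 2) : ℂ)‖
        ≤ Real.pi ^ 2 * M / (n : ℝ) ^ α * (1 / ((r : ℝ) + 1) + 1 / ((m : ℝ) - r)) := by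
      intro r hr
      have := Finset.mem_range.1 hr
      refine (norm_far_cell_error_le hα hα1 hy h0 hh (by omega : 2 ≤ r + 2) (by omega)).trans
        (le_of_eq ?_)
      rw [hmc]; push_cast; congr 3 <;> ring
    refine (norm_sum_le _ _).trans ((Finset.sum_le_sum hterm).trans ?_)
    rw [← Finset.mul_sum]
    have h1 := sum_inv_add_inv_reflect_le (by omega : m ≤ 2 * n)
    have h2 := one_add_log_two_mul_le hn
    exact mul_le_mul_of_nonneg_left (by linarith) (by positivity)
  rw [Finset.sum_sub_distrib] at hC
  have hL := half_le_log hn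
  -- Regroups into central, far and neighbouring contributions; the last has no counterpart in the
  -- quadrature sum.
  have alg : ∀ w S I0 I1 T Im Il : ℂ,
      w + S - (I0 + (T + I1 + Im) + Il) = (w - I0 - Il) + (S - T) - (Im + I1) := by
    intros; ring
  rw [alg]
  refine (norm_sub_le _ _).trans ((add_le_add ((norm_add_le _ _).trans
    (add_le_add hA hC)) hB).trans ?_)
  have hNα : 0 < (n : ℝ) ^ α := Real.rpow_pos_of_pos hn0 α
  have e3 : 2 * (Real.pi * M * (Real.pi / (n : ℝ) ^ α) / α)
      + Real.pi ^ 2 * M / (n : ℝ) ^ α * (8 * Real.log n)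
      + 2 * (Real.pi * (M + 2 * Real.pi) * (2 * Real.pi / (n : ℝ) ^ α) / α)
      = (2 * (Real.pi * M * Real.pi) + 2 * (Real.pi * (M + 2 * Real.pi) * (2 * Real.pi)))
          / α / (n : ℝ) ^ α * 1 + 8 * (Real.pi ^ 2 * M) * Real.log n / (n : ℝ) ^ α := by
    field_simp
    ring
  have e4 : quadratureConst α M * Real.log n / (n : ℝ) ^ α
      = (2 * (Real.pi * M * Real.pi) + 2 * (Real.pi * (M + 2 * Real.pi) * (2 * Real.pi)))
          / α / (n : ℝ) ^ α * (2 * Real.log n)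
        + 8 * (Real.pi ^ 2 * M) * Real.log n / (n : ℝ) ^ α := by
    rw [quadratureConst]; field_simp; ring
  rw [e3, e4]
  gcongr
  linarith

/-! ### The regular integral -/

theorem norm_riemann_sum_error_le {α L : ℝ} {G : ℝ → ℂ} (hα : 0 < α) (hα1 : α ≤ 1)
    (hG : IsHolder α L G) {n : ℕ} (hn : 1 ≤ n) {h : ℝ} (h0 : 0 < h) (hh : h < Real.pi / n) :
    ‖1 / (2 * n) * ∑ k : Fin (2 * n), G (shiftedKnot n h (k : ℕ))
      - 1 / (2 * Real.pi) * ∫ σ in (0 : ℝ)..(2 * Real.pi), G σ‖ ≤ L * (Real.pi / (n : ℝ) ^ α) := by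
  have hpi := Real.pi_pos
  have hL := hG.const_nonneg
  have hn0 : (0 : ℝ) < n := by exact_mod_cast hn
  have hnC : (n : ℂ) ≠ 0 := by exact_mod_cast hn0.ne'
  have hpiC : (Real.pi : ℂ) ≠ 0 := by exact_mod_cast hpi.ne'
  have hGc := hG.continuous hα
  have step : ∀ k : ℕ, knot n ((k + 1 : ℕ) : ℤ) - knot n (k : ℤ) = Real.pi / n := by
    intro k; simp only [knot]; push_cast; ring
  have hle : ∀ k : ℕ, knot n (k : ℤ) ≤ knot n ((k + 1 : ℕ) : ℤ) := by
    intro k; linarith [step k, show 0 < Real.pi / n by positivity]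
  have hsplit := intervalIntegral.sum_integral_adjacent_intervals (f := G)
    (μ := MeasureTheory.volume) (a := fun k : ℕ => knot n (k : ℤ)) (n := 2 * n)
    fun k _ => hGc.intervalIntegrable _ _
  have k0 : knot n ((0 : ℕ) : ℤ) = 0 := by simp [knot]
  have k1 : knot n ((2 * n : ℕ) : ℤ) = 2 * Real.pi := by
    simp only [knot]; push_cast; field_simp
  simp only [k0, k1] at hsplit
  have hcell : ∀ k ∈ Finset.range (2 * n), ‖((Real.pi / n : ℝ) : ℂ) * G (shiftedKnot n h (k : ℕ))
      - ∫ σ in knot n (k : ℤ)..knot n ((k + 1 : ℕ) : ℤ), G σ‖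
      ≤ L * (Real.pi / (n : ℝ) ^ α) * (Real.pi / n) := by
    intro k _
    have e : ((Real.pi / n : ℝ) : ℂ) * G (shiftedKnot n h (k : ℕ))
        - ∫ σ in knot n (k : ℤ)..knot n ((k + 1 : ℕ) : ℤ), G σ
        = ∫ σ in knot n (k : ℤ)..knot n ((k + 1 : ℕ) : ℤ), (G (shiftedKnot n h (k : ℕ)) - G σ) := by
      rw [intervalIntegral.integral_sub (continuous_const.intervalIntegrable _ _)
        (hGc.intervalIntegrable _ _), intervalIntegral.integral_const, step]
      simp
    rw [e]
    have := intervalIntegral.norm_integral_le_of_norm_le_const (a := knot n (k : ℤ))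
      (b := knot n ((k + 1 : ℕ) : ℤ)) (f := fun σ => G (shiftedKnot n h (k : ℕ)) - G σ)
      (C := L * (Real.pi / (n : ℝ) ^ α)) fun σ hσ => by
        rw [Set.uIoc_of_le (hle k)] at hσ
        refine (hG.2 _ _).trans ?_
        gcongr
        refine (Real.rpow_le_rpow (abs_nonneg _) ?_ hα.le).trans (pi_div_rpow_le hα1 n)
        have s1 := hσ.1
        have s2 := hσ.2
        have s3 := step k
        simp only [shiftedKnot]
        rw [abs_le]; constructor <;> linarith
    rwa [step, abs_of_pos (by positivity)] at this
  have hsum := (norm_sum_le _ _).trans (Finset.sum_le_sum hcell)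
  rw [Finset.sum_sub_distrib, hsplit, ← Finset.mul_sum, Finset.sum_const, Finset.card_range,
    nsmul_eq_mul] at hsum
  rw [Fin.sum_univ_eq_sum_range (fun k : ℕ => G (shiftedKnot n h (k : ℕ)))]
  have e : 1 / (2 * (n : ℂ)) * ∑ k ∈ Finset.range (2 * n), G (shiftedKnot n h (k : ℕ))
      - 1 / (2 * Real.pi) * ∫ σ in (0 : ℝ)..(2 * Real.pi), G σ
      = ((1 / (2 * Real.pi) : ℝ) : ℂ) *
        (((Real.pi / n : ℝ) : ℂ) * ∑ k ∈ Finset.range (2 * n), G (shiftedKnot n h (k : ℕ))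
          - ∫ σ in (0 : ℝ)..(2 * Real.pi), G σ) := by
    push_cast; field_simp
  rw [e, norm_mul, Complex.norm_real, Real.norm_eq_abs, abs_of_pos (by positivity)]
  calc _ ≤ 1 / (2 * Real.pi) * (((2 * n : ℕ) : ℝ) * (L * (Real.pi / (n : ℝ) ^ α) * (Real.pi / n))) := by
        gcongr
    _ = _ := by push_cast; field_simp

theorem IsHolderKernel.mul_holder {α M : ℝ} (hα : 0 < α) {H : ℝ → ℝ → ℂ} {x : ℝ → ℂ}
    (hH : IsHolderKernel α M H) (hHM : ∀ s σ, ‖H s σ‖ ≤ M) (hx : IsHolder α M x)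
    (hxM : ∀ s, ‖x s‖ ≤ M) (s : ℝ) : IsHolder α (2 * M ^ 2) fun σ => H s σ * x σ := by
  have hM := hx.const_nonneg
  refine ⟨fun σ => ?_, fun σ τ => ?_⟩
  · have h1 := hH.2.1 s σ
    have h2 := hx.1 σ
    simp only [h1, h2]
  · have e : H s σ * x σ - H s τ * x τ = H s σ * (x σ - x τ) + (H s σ - H s τ) * x τ := by ring
    have h1 := hH.2.2 s s σ τ
    rw [sub_self, abs_zero, Real.zero_rpow hα.ne', zero_add] at h1
    rw [e]
    refine (norm_add_le _ _).trans ?_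
    rw [norm_mul, norm_mul]
    have h2 := mul_le_mul (hHM s σ) (hx.2 σ τ) (norm_nonneg _) hM
    have h3 := mul_le_mul h1 (hxM τ) (norm_nonneg _) (by positivity)
    linarith

/-! ### Solvability and stability of the quadrature system -/

theorem solvesSystem_iff {n : ℕ} {h : ℝ} {a b : ℝ → ℂ} {H : ℝ → ℝ → ℂ} {f : ℝ → ℂ}
    {c : Fin (2 * n) → ℂ} : SolvesSystem n h a b H f c ↔
      (systemMatrix n h a b H * collocation n h).mulVec c
        = fun j : Fin (2 * n) => f (shiftedKnot n h (j : ℕ)) := by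
  rw [funext_iff, SolvesSystem]
  refine forall_congr' fun j => ?_
  rw [← Matrix.mulVec_mulVec]
  simp only [Matrix.mulVec, dotProduct, collocation, approxSol, mul_comm (basisFun n h _ _ : ℂ)]

theorem existsUnique_solvesSystem {n : ℕ} (hn : 1 ≤ n) {h δ : ℝ} (hδ : 0 < δ) {a b : ℝ → ℂ}
    {H : ℝ → ℝ → ℂ} (f : ℝ → ℂ) (hC : DiagDominant δ (systemMatrix n h a b H)) :
    ∃! c : Fin (2 * n) → ℂ, SolvesSystem n h a b H f c := by
  have hdet : (systemMatrix n h a b H).det ≠ 0 :=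
    det_ne_zero_of_sum_row_lt_diag fun j => by linarith [hC j]
  have hu : IsUnit (systemMatrix n h a b H * collocation n h) := by
    rw [Matrix.isUnit_iff_isUnit_det, Matrix.det_mul]
    exact (mul_ne_zero hdet (collocation_det_ne_zero hn h)).isUnit
  simp only [solvesSystem_iff]
  exact Function.Bijective.existsUnique ⟨Matrix.mulVec_injective_iff_isUnit.2 hu,
    Matrix.mulVec_surjective_iff_isUnit.2 hu⟩ _

/-- In the row where `‖e j‖` is largest, the off-diagonal terms are dominated by the diagonal one up
to the gap, leaving `δ ‖e j‖ ≤ R`. -/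
theorem DiagDominant.norm_le {n : ℕ} {δ R : ℝ} (hδ : 0 < δ)
    {C : Matrix (Fin (2 * n)) (Fin (2 * n)) ℂ} (hC : DiagDominant δ C) {e : Fin (2 * n) → ℂ}
    (hR : ∀ j, ‖∑ k, C j k * e k‖ ≤ R) (k : Fin (2 * n)) : ‖e k‖ ≤ R / δ := by
  have : Nonempty (Fin (2 * n)) := ⟨k⟩
  obtain ⟨j, hj⟩ := Finite.exists_max fun k => ‖e k‖
  refine (hj k).trans ?_
  rw [le_div_iff₀ hδ]
  have h1 : C j j * e j = ∑ k, C j k * e k - ∑ k ∈ Finset.univ.erase j, C j k * e k := by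
    rw [← Finset.add_sum_erase Finset.univ (fun k => C j k * e k) (Finset.mem_univ j)]; ring
  have h2 : ‖∑ k ∈ Finset.univ.erase j, C j k * e k‖
      ≤ (∑ k ∈ Finset.univ.erase j, ‖C j k‖) * ‖e j‖ := by
    rw [Finset.sum_mul]
    refine (norm_sum_le _ _).trans (Finset.sum_le_sum fun k _ => ?_)
    rw [norm_mul]
    exact mul_le_mul_of_nonneg_left (hj k) (norm_nonneg _)
  have h3 : ‖C j j‖ * ‖e j‖ ≤ R + (∑ k ∈ Finset.univ.erase j, ‖C j k‖) * ‖e j‖ := by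
    rw [← norm_mul, h1]
    exact (norm_sub_le _ _).trans (add_le_add (hR j) h2)
  have h4 := mul_le_mul_of_nonneg_right (hC j) (norm_nonneg (e j))
  linarith

/-! ### Diagonal dominance for small shifts -/

theorem not_neighbor_self {n : ℕ} (j : Fin (2 * n)) : ¬Neighbor j j := by
  have hj := j.2
  rw [neighbor_offset_iff j (i := 0) (by omega) (by rw [add_zero, Nat.mod_eq_of_lt hj])]
  omega

theorem exists_offset {n : ℕ} (j k : Fin (2 * n)) :
    ∃ i < 2 * n, (k : ℕ) = (j + i) % (2 * n) := by
  have hj := j.2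
  have hk := k.2
  rcases le_total (j : ℕ) k with h | h
  · exact ⟨k - j, by omega, by rw [Nat.add_sub_cancel' h, Nat.mod_eq_of_lt hk]⟩
  · rcases h.eq_or_lt with h | h
    · exact ⟨0, by omega, by rw [add_zero, Nat.mod_eq_of_lt hj, h]⟩
    · refine ⟨k + 2 * n - j, by omega, ?_⟩
      rw [add_mod_of_lt hj (by omega)]
      split_ifs <;> omega

theorem abs_cellWeight_le {n : ℕ} {h : ℝ} (h0 : 0 < h) (hh : h < Real.pi / n)
    {j k : Fin (2 * n)} (hjk : k ≠ j) (hN : ¬Neighbor j k) : |cellWeight n h j k| ≤ 2 * Real.pi := by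
  obtain ⟨i, hi, hk⟩ := exists_offset j k
  have h1 : i ≠ 0 := fun e => hjk ((offset_eq_iff j hi hk).2 e)
  rw [neighbor_offset_iff j hi hk] at hN
  rw [cellWeight_offset h0 hh j (by omega) hi hk]
  exact abs_cellIntegral_le h0 hh (by omega) (by omega)

theorem exists_le_cellWeight_self {n : ℕ} (hn : 1 ≤ n) (K : ℝ) :
    ∃ h₀ : ℝ, 0 < h₀ ∧ h₀ ≤ Real.pi / (2 * n) ∧ ∀ h : ℝ, 0 < h → h ≤ h₀ →
      ∀ j : Fin (2 * n), 2 * K ≤ cellWeight n h j j := by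
  have hpi := Real.pi_pos
  have hn1 : (1 : ℝ) ≤ n := by exact_mod_cast hn
  have hd : 0 < Real.pi / (2 * n) := by positivity
  have hdd : Real.pi / n = Real.pi / (2 * n) + Real.pi / (2 * n) := by field_simp; norm_num
  have hpn : Real.pi / n ≤ Real.pi := div_le_self hpi.le hn1
  set S := Real.sin (Real.pi / (2 * n) / 2) with hS
  have hS0 : 0 < S := Real.sin_pos_of_pos_of_lt_pi (by linarith) (by linarith)
  -- The first bound keeps `sin ((π/n - h)/2) ≥ S`. The second, with `sin (h/2) ≤ h/2`, gives `log
  -- sin (h/2) ≤ log S - K`.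
  refine ⟨min (Real.pi / (2 * n)) (2 * Real.exp (Real.log S - K)), lt_min hd (by positivity),
    min_le_left _ _, fun h h0 hh j => ?_⟩
  have h1 := hh.trans (min_le_left _ _)
  have h2 := hh.trans (min_le_right _ _)
  rw [cellWeight_self h0 (by linarith)]
  have h3 : Real.log S ≤ Real.log (Real.sin ((Real.pi / n - h) / 2)) :=
    Real.log_le_log hS0 (Real.sin_le_sin_of_le_of_le_pi_div_two (by linarith) (by linarith)
      (by linarith))
  have h4 : Real.log (Real.sin (h / 2)) ≤ Real.log S - K := by
    rw [Real.log_le_iff_le_exp (Real.sin_pos_of_pos_of_lt_pi (by linarith) (by linarith))]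
    linarith [Real.sin_le (by linarith : 0 ≤ h / 2)]
  linarith

theorem exists_diagDominant {α M δ : ℝ} (hα : 0 < α) {a b : ℝ → ℂ} {H : ℝ → ℝ → ℂ}
    (ha : ∃ L, IsHolder α L a) (hb : IsHolder α M b) (hbM : ∀ s, ‖b s‖ ≤ M) (hb0 : ∀ s, b s ≠ 0)
    (hHM : ∀ s σ, ‖H s σ‖ ≤ M) {n : ℕ} (hn : 1 ≤ n) :
    ∃ h₀ : ℝ, 0 < h₀ ∧ h₀ ≤ Real.pi / (2 * n) ∧ ∀ h : ℝ, 0 < h → h ≤ h₀ →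
      DiagDominant δ (systemMatrix n h a b H) := by
  have hpi := Real.pi_pos
  have hM := hb.const_nonneg
  have hn1 : (1 : ℝ) ≤ n := by exact_mod_cast hn
  obtain ⟨La, ha⟩ := ha
  have hne : (Set.Icc 0 (2 * Real.pi)).Nonempty := ⟨0, by simp [hpi.le]⟩
  obtain ⟨s₁, -, hs₁⟩ := isCompact_Icc.exists_isMinOn hne (hb.continuous hα).norm.continuousOn
  obtain ⟨s₂, -, hs₂⟩ := isCompact_Icc.exists_isMaxOn hne (ha.continuous hα).norm.continuousOn
  have hβ : 0 < ‖b s₁‖ := norm_pos_iff.2 (hb0 s₁)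
  -- What the singular part of the diagonal must exceed: `2n` off-diagonal entries of at most `2M`
  -- each, the gap `δ`, the coefficient `a`, and the diagonal kernel term. The factor `π / ‖b s₁‖`
  -- below compensates for `b / (2π)` and the `2` in `2 * K`.
  set K := 2 * n * (2 * M) + δ + ‖a s₂‖ + M with hK
  obtain ⟨h₀, h₀0, h₀1, hw⟩ := exists_le_cellWeight_self hn (Real.pi / ‖b s₁‖ * |K|)
  refine ⟨h₀, h₀0, h₀1, fun h h0 hh j => ?_⟩
  have hhn : h ≤ Real.pi / (2 * n) := hh.trans h₀1
  have hdd : Real.pi / n = Real.pi / (2 * n) + Real.pi / (2 * n) := by field_simp; norm_num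
  have hd : 0 < Real.pi / (2 * n) := by positivity
  have hhn' : h < Real.pi / n := by linarith
  have hmem : shiftedKnot n h (j : ℕ) ∈ Set.Icc 0 (2 * Real.pi) := by
    have hj : ((j : ℕ) : ℝ) + 1 ≤ 2 * n := by exact_mod_cast j.2
    have e1 : Real.pi * ((j : ℕ) : ℝ) / n + Real.pi / n ≤ 2 * Real.pi := by
      rw [← add_div, div_le_iff₀ (by linarith)]
      nlinarith
    have e2 : 0 ≤ Real.pi * ((j : ℕ) : ℝ) / n := by positivity
    simp only [shiftedKnot, knot, Int.cast_natCast]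
    constructor <;> linarith
  have hbj : ‖b s₁‖ ≤ ‖b (shiftedKnot n h (j : ℕ))‖ := hs₁ hmem
  have haj : ‖a (shiftedKnot n h (j : ℕ))‖ ≤ ‖a s₂‖ := hs₂ hmem
  have hHjk : ∀ k : Fin (2 * n), ‖1 / (2 * n) * H (shiftedKnot n h (j : ℕ))
      (shiftedKnot n h (k : ℕ))‖ ≤ M := by
    intro k
    have : ‖(1 : ℂ) / (2 * n)‖ ≤ 1 := by
      rw [norm_div, norm_one, norm_mul, Complex.norm_natCast, Complex.norm_ofNat, div_le_one] <;>
        linarith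
    rw [norm_mul]
    exact (mul_le_mul this (hHM _ _) (norm_nonneg _) zero_le_one).trans (one_mul M).le
  have hnorm : ∀ w : ℝ, ‖b (shiftedKnot n h (j : ℕ)) / (2 * Real.pi) * (w : ℂ)‖
      = ‖b (shiftedKnot n h (j : ℕ))‖ / (2 * Real.pi) * |w| := by
    intro w
    rw [norm_mul, norm_div, norm_mul, Complex.norm_real, Complex.norm_real, Complex.norm_ofNat,
      Real.norm_eq_abs, Real.norm_eq_abs, abs_of_pos hpi]
  have hoff : ∀ k ∈ Finset.univ.erase j, ‖systemMatrix n h a b H j k‖ ≤ 2 * M := by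
    intro k hk
    have hkj := Finset.ne_of_mem_erase hk
    rw [systemMatrix, if_neg hkj, zero_add, two_mul M]
    refine (norm_add_le _ _).trans (add_le_add ?_ (hHjk k))
    split_ifs with hN
    · simpa using hM
    · rw [hnorm]
      calc _ ≤ M / (2 * Real.pi) * (2 * Real.pi) := by
            gcongr
            · exact hbM _
            · exact abs_cellWeight_le h0 hhn' hkj hN
        _ = M := by field_simp
  have hsum : ∑ k ∈ Finset.univ.erase j, ‖systemMatrix n h a b H j k‖ ≤ 2 * n * (2 * M) := by
    refine (Finset.sum_le_sum hoff).trans ?_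
    rw [Finset.sum_const, nsmul_eq_mul]
    gcongr
    have := Finset.card_le_univ (Finset.univ.erase j)
    rw [Fintype.card_fin] at this
    exact_mod_cast this
  have hdiag : |K| ≤ ‖b (shiftedKnot n h (j : ℕ)) / (2 * Real.pi) * (cellWeight n h j j : ℂ)‖ := by
    rw [hnorm]
    calc |K| = ‖b s₁‖ / (2 * Real.pi) * (2 * (Real.pi / ‖b s₁‖ * |K|)) := by field_simp
      _ ≤ _ := by
        gcongr
        exact (hw h h0 hh j).trans (le_abs_self _)
  have hCjj : b (shiftedKnot n h (j : ℕ)) / (2 * Real.pi) * (cellWeight n h j j : ℂ)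
      = systemMatrix n h a b H j j - a (shiftedKnot n h (j : ℕ))
        - 1 / (2 * n) * H (shiftedKnot n h (j : ℕ)) (shiftedKnot n h (j : ℕ)) := by
    rw [systemMatrix, if_pos rfl, if_neg (not_neighbor_self j)]; ring
  rw [hCjj] at hdiag
  have h5 := hdiag.trans ((norm_sub_le _ _).trans (add_le_add_left (norm_sub_le _ _) _))
  linarith [hHjk j, le_abs_self K]

/-! ### The error estimate -/

theorem sum_systemMatrix_mul {n : ℕ} {h : ℝ} {a b : ℝ → ℂ} {H : ℝ → ℝ → ℂ} (j : Fin (2 * n))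
    (v : Fin (2 * n) → ℂ) [∀ k, Decidable (Neighbor j k)] :
    ∑ k, systemMatrix n h a b H j k * v k = a (shiftedKnot n h (j : ℕ)) * v j
      + b (shiftedKnot n h (j : ℕ)) / (2 * Real.pi)
        * ∑ k, (if Neighbor j k then 0 else (cellWeight n h j k : ℂ)) * v k
      + 1 / (2 * n) * ∑ k : Fin (2 * n),
        H (shiftedKnot n h (j : ℕ)) (shiftedKnot n h (k : ℕ)) * v k := by
  have e : ∀ k, systemMatrix n h a b H j k * v k
      = (if k = j then a (shiftedKnot n h (j : ℕ)) * v k else 0)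
        + b (shiftedKnot n h (j : ℕ)) / (2 * Real.pi)
          * ((if Neighbor j k then 0 else (cellWeight n h j k : ℂ)) * v k)
        + 1 / (2 * n) * (H (shiftedKnot n h (j : ℕ)) (shiftedKnot n h (k : ℕ)) * v k) := by
    intro k
    rw [systemMatrix]
    split_ifs <;> ring
  simp only [e, Finset.sum_add_distrib, ← Finset.mul_sum]
  simp

/-- The constant in the bound of the residual of the exact solution in the quadrature system. -/
noncomputable def residualConst (α M : ℝ) : ℝ :=
  M * quadratureConst α M + 2 * (2 * M ^ 2 * Real.pi)

open Classical in
-- The integral equation at the collocation point eliminates `f`, and the terms with `a` cancel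
-- exactly. Only the errors of the two quadrature formulas remain.
theorem norm_residual_le {α M : ℝ} (hα : 0 < α) (hα1 : α ≤ 1) {a b f x : ℝ → ℂ} {H : ℝ → ℝ → ℂ}
    (hbM : ∀ s, ‖b s‖ ≤ M) (hH : IsHolderKernel α M H) (hHM : ∀ s σ, ‖H s σ‖ ≤ M)
    (hx : IsHolder α M x) (hxM : ∀ s, ‖x s‖ ≤ M) (hsol : IsSolution a b H f x) {n : ℕ} (hn : 2 ≤ n)
    {h : ℝ} (h0 : 0 < h) (hh : h < Real.pi / n) (j : Fin (2 * n)) {κ : ℂ}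
    (hκ : IsAuxSlope n h x (j : ℕ) κ) (hκ' : ‖κ‖ ≤ (n : ℝ) ^ (1 - α)) :
    ‖∑ k, systemMatrix n h a b H j k * x (shiftedKnot n h (k : ℕ))
      - f (shiftedKnot n h (j : ℕ))‖ ≤ residualConst α M * Real.log n / (n : ℝ) ^ α := by
  have hpi := Real.pi_gt_three
  have hM := hx.const_nonneg
  have hn0 : (0 : ℝ) < n := by exact_mod_cast (by omega : 0 < n)
  have hNα : 0 < (n : ℝ) ^ α := Real.rpow_pos_of_pos hn0 α
  have hL := half_le_log hn
  obtain ⟨p, hp, heq⟩ := hsol (shiftedKnot n h (j : ℕ))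
  have hQ := norm_quadrature_error_le hα hα1 hx hn h0 hh j hκ hκ' hp
  have hR := norm_riemann_sum_error_le hα hα1
    (hH.mul_holder hα hHM hx hxM (shiftedKnot n h (j : ℕ))) (by omega : 1 ≤ n) h0 hh
  rw [sum_systemMatrix_mul, ← heq]
  have alg : ∀ A β S I P J : ℂ, A + β * S + I - (A + β * P + J) = β * (S - P) + (I - J) := by
    intros; ring
  rw [alg]
  have hb : ‖b (shiftedKnot n h (j : ℕ)) / (2 * Real.pi)‖ ≤ M := by
    rw [norm_div, norm_mul, Complex.norm_real, Complex.norm_ofNat, Real.norm_eq_abs,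
      abs_of_pos Real.pi_pos]
    exact (div_le_self (norm_nonneg _) (by linarith)).trans (hbM _)
  refine (norm_add_le _ _).trans ?_
  rw [norm_mul]
  calc _ ≤ M * (quadratureConst α M * Real.log n / (n : ℝ) ^ α)
        + 2 * M ^ 2 * (Real.pi / (n : ℝ) ^ α) * 1 := by
        rw [mul_one]
        exact add_le_add (mul_le_mul hb hQ (norm_nonneg _) hM) hR
    _ ≤ M * (quadratureConst α M * Real.log n / (n : ℝ) ^ α)
        + 2 * M ^ 2 * (Real.pi / (n : ℝ) ^ α) * (2 * Real.log n) := by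
        gcongr; linarith
    _ = _ := by rw [residualConst]; ring

/-- As the Lagrange kernels sum to `1`, the error splits into the interpolation error of `x` and the
interpolant of the nodal errors, the latter being amplified by the Lebesgue constant. -/
theorem norm_sub_approxSol_le {α M R : ℝ} (hα : 0 < α) (hα1 : α ≤ 1) {x : ℝ → ℂ}
    (hx : IsHolder α M x) {n : ℕ} (hn : 2 ≤ n) {h : ℝ} {c : Fin (2 * n) → ℂ}
    (hR : ∀ k : Fin (2 * n),
      ‖x (shiftedKnot n h (k : ℕ)) - approxSol n h c (shiftedKnot n h (k : ℕ))‖ ≤ R) (s : ℝ) :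
    ‖x s - approxSol n h c s‖
      ≤ 12 * Real.pi ^ 2 * M * Real.log n / (n : ℝ) ^ α + R * (8 * Real.log n) := by
  have hn1 : 1 ≤ n := by omega
  have hR0 : 0 ≤ R := (norm_nonneg _).trans (hR ⟨0, by omega⟩)
  have h1 : ∑ k : Fin (2 * n), (lagrange n (s - shiftedKnot n h (k : ℕ)) : ℂ) = 1 := by
    have := sum_lagrange hn1 h s
    rw [← Fin.sum_univ_eq_sum_range (fun k : ℕ => lagrange n (s - shiftedKnot n h (k : ℕ)))] at this
    exact_mod_cast this
  have e : x s - approxSol n h c s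
      = ∑ k : Fin (2 * n), (x s - x (shiftedKnot n h (k : ℕ)))
          * (lagrange n (s - shiftedKnot n h (k : ℕ)) : ℂ)
        + ∑ k : Fin (2 * n), (x (shiftedKnot n h (k : ℕ))
          - approxSol n h c (shiftedKnot n h (k : ℕ)))
          * (lagrange n (s - shiftedKnot n h (k : ℕ)) : ℂ) := by
    rw [approxSol_eq_sum_lagrange hn1 h c s]
    simp only [sub_mul, Finset.sum_sub_distrib, ← Finset.mul_sum, h1]
    ring
  rw [e]
  refine (norm_add_le _ _).trans (add_le_add (norm_sum_sub_mul_lagrange_le hα hα1 hx hn h s) ?_)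
  refine (norm_sum_le _ _).trans ?_
  calc _ ≤ ∑ k : Fin (2 * n), R * |lagrange n (s - shiftedKnot n h (k : ℕ))| := by
        refine Finset.sum_le_sum fun k _ => ?_
        rw [norm_mul, Complex.norm_real, Real.norm_eq_abs]
        exact mul_le_mul_of_nonneg_right (hR k) (abs_nonneg _)
    _ ≤ _ := by
        rw [← Finset.mul_sum]
        exact mul_le_mul_of_nonneg_left (sum_abs_lagrange_le hn h s) hR0

end HilbertSIE

theorem theorem8p1 (α M δ : ℝ) (hα : 0 < α) (hα1 : α ≤ 1) (hδ : 0 < δ) :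
    ∃ A : ℝ, ∀ (a b f : ℝ → ℂ) (H : ℝ → ℝ → ℂ) (x : ℝ → ℂ),
      (∃ L, HilbertSIE.IsHolder α L a) →
      (∃ L, HilbertSIE.IsHolder α L f) →
      HilbertSIE.IsHolder α M b → (∀ s, ‖b s‖ ≤ M) →
      HilbertSIE.IsHolderKernel α M H → (∀ s σ, ‖H s σ‖ ≤ M) →
      (∀ s, b s ≠ 0) →
      HilbertSIE.IsHolder α M x → (∀ s, ‖x s‖ ≤ M) →
      HilbertSIE.IsSolution a b H f x →
      (∀ y : ℝ → ℂ, (∃ L, HilbertSIE.IsHolder α L y) →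
        HilbertSIE.IsSolution a b H f y → y = x) →
      (∀ n : ℕ, 1 ≤ n → ∃ h₀ : ℝ, 0 < h₀ ∧ h₀ ≤ Real.pi / (2 * n) ∧
        ∀ h : ℝ, 0 < h → h ≤ h₀ →
          HilbertSIE.DiagDominant δ (HilbertSIE.systemMatrix n h a b H) ∧
          ∃! c : Fin (2 * n) → ℂ, HilbertSIE.SolvesSystem n h a b H f c) ∧
      (∀ (n : ℕ) (h : ℝ), 2 ≤ n → 0 < h → h ≤ Real.pi / (2 * n) →
        HilbertSIE.DiagDominant δ (HilbertSIE.systemMatrix n h a b H) →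
        (∃! c : Fin (2 * n) → ℂ, HilbertSIE.SolvesSystem n h a b H f c) ∧
        ∀ c κ : Fin (2 * n) → ℂ, HilbertSIE.SolvesSystem n h a b H f c →
          (∀ j : Fin (2 * n),
            HilbertSIE.IsAuxSlope n h x (j : ℕ) (κ j) ∧ ‖κ j‖ ≤ (n : ℝ) ^ (1 - α)) →
          ∀ s : ℝ, ‖x s - HilbertSIE.approxSol n h c s‖
            ≤ A * Real.log n ^ 3 / (n : ℝ) ^ α) := by
  open HilbertSIE in
  -- The factors `4` and `2` come from `L ≤ 4 L³` and `L² ≤ 2 L³`, valid since `L = log n ≥ 1/2`; `8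
  -- log n` is the Lebesgue constant and `1/δ` the stability constant.
  refine ⟨4 * (12 * Real.pi ^ 2 * M) + 2 * (8 * (residualConst α M / δ)),
    fun a b f H x ha hf hb hbM hH hHM hb0 hx hxM hsol huniq =>
      ⟨fun n hn => ?_, fun n h hn h0 hh hC => ⟨?_, ?_⟩⟩⟩
  · obtain ⟨h₀, h1, h2, h3⟩ := exists_diagDominant (δ := δ) hα ha hb hbM hb0 hHM hn
    exact ⟨h₀, h1, h2, fun h h0 hh =>
      ⟨h3 h h0 hh, existsUnique_solvesSystem hn hδ f (h3 h h0 hh)⟩⟩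
  · exact existsUnique_solvesSystem (by omega) hδ f hC
  · intro c κ hc hκ s
    have hpi := Real.pi_pos
    have hM := hx.const_nonneg
    have hn0 : (0 : ℝ) < n := by exact_mod_cast (by omega : 0 < n)
    have hNα : 0 < (n : ℝ) ^ α := Real.rpow_pos_of_pos hn0 α
    have hL := half_le_log hn
    have hhn : h < Real.pi / n := by
      refine hh.trans_lt (div_lt_div_of_pos_left hpi hn0 (by linarith))
    -- Because `x_n` solves the system exactly, the matrix sends the nodal errors to the residual of
    -- `x`.
    have hres : ∀ j : Fin (2 * n), ‖∑ k, systemMatrix n h a b H j k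
        * (x (shiftedKnot n h (k : ℕ)) - approxSol n h c (shiftedKnot n h (k : ℕ)))‖
        ≤ residualConst α M * Real.log n / (n : ℝ) ^ α := by
      intro j
      simp only [mul_sub, Finset.sum_sub_distrib]
      rw [hc j]
      exact norm_residual_le hα hα1 hbM hH hHM hx hxM hsol hn h0 hhn j (hκ j).1 (hκ j).2
    refine (norm_sub_approxSol_le hα hα1 hx hn (fun k => hC.norm_le hδ hres k) s).trans ?_
    have hres0 : 0 ≤ residualConst α M := by
      unfold residualConst quadratureConst; positivity
    set L := Real.log n
    have l1 : L ≤ 4 * L ^ 3 := by nlinarith [mul_nonneg (by linarith : 0 ≤ L) (by nlinarith : 0 ≤ 4 * L ^ 2 - 1)]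
    have l2 : L * L ≤ 2 * L ^ 3 := by nlinarith [mul_nonneg (mul_self_nonneg L) (by linarith : 0 ≤ 2 * L - 1)]
    calc _ = 12 * Real.pi ^ 2 * M / (n : ℝ) ^ α * L
          + 8 * (residualConst α M / δ) / (n : ℝ) ^ α * (L * L) := by ring
      _ ≤ 12 * Real.pi ^ 2 * M / (n : ℝ) ^ α * (4 * L ^ 3)
          + 8 * (residualConst α M / δ) / (n : ℝ) ^ α * (2 * L ^ 3) := by gcongr
      _ = _ := by ring
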